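/- **Definitions.** Let $\{0,1\}^*$ be the set of finite binary strings and $A \subseteq \{0,1\}^*$ an oracle. A prefix-free machine with oracle $A$ is a partial function $M$ of a program $\pi$ and side information $\tau$ (strings, with string values) that is computable with oracle $A$ and such that, for each $\tau$, no program on which $M(\cdot,\tau)$ halts is a proper prefix of another. It is universal if it is such a machine, and for every prefix-free machine $M$ with oracle $A$ there is a string $\pi_M$ with $U^A(\pi_M\sigma,\tau) = M(\sigma,\tau)$ for all $\sigma,\tau$ (one side being defined if and only if the other is). Fix a universal prefix-free machine $U^A$ with oracle $A$, put $$K^A(\sigma \mid \tau) := \min\{|\pi| : U^A(\pi,\tau) = \sigma\}, \qquad K^A(\sigma) := K^A(\sigma \mid \emptyset),$$ where $\emptyset$ is the empty string, and identify rational vectors (of all dimensions) with strings by a fixed effective encoding. For $x \in \mathbb{R}^n$, $y \in \mathbb{R}^m$ and $r \in \mathbb{N}$ let $$K_r^A(x) := \min_{p \in B(x,2^{-r}) \cap \mathbb{Q}^n} K^A(p), \qquad K_r^A(x \mid y) := \max_{q \in B(y,2^{-r}) \cap \mathbb{Q}^m} \ \min_{p \in B(x,2^{-r}) \cap \mathbb{Q}^n}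 K^A(p \mid q),$$ with $B$ denoting open Euclidean balls. **Lemma 4.1.** For all $n \in \mathbb{N}$, $y \in \mathbb{R}^n$, $A \subseteq \{0,1\}^*$ and $\varepsilon > 0$, there exists a dense set of points $x \in \mathbb{R}$ such that, for all sufficiently large $r \in \mathbb{N}$ (depending on $x$), $$K_r^A(y \mid x) \leq \max\{K_r^A(y) - (1-\varepsilon) r,\ \varepsilon r\}.$$ -/

import Mathlib

/-
Prefix-free Kolmogorov complexity of finite strings and of points of Euclidean space, relative to
an oracle. Computability relative to an oracle is Mathlib's `RecursiveIn`.
-/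

namespace AlgInfo

section Definitions

/-- The oracle `A ⊆ {0,1}*`, as the characteristic function of (the codes of the strings in) `A`. -/
noncomputable def oracleChar (A : Set (List Bool)) : ℕ → ℕ :=
  open scoped Classical in fun k => if ∃ σ ∈ A, Encodable.encode σ = k then 1 else 0

/-- `M` is a prefix-free machine with oracle `A`: the partial function `(π, τ) ↦ M π τ` of the
program `π` and the side information `τ` is computable with oracle `A`, and, for each `τ`, no
halting program is a proper prefix of another halting program. -/
structure IsPrefixFreeMachine (A : Set (List Bool)) (M : List Bool → List Bool →. List Bool) :
    Prop where
  recursive : RecursiveIn₂ {(oracleChar A : ℕ →. ℕ)} M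
  prefixFree : ∀ τ π₁ π₂ : List Bool, (M π₁ τ).Dom → (M π₂ τ).Dom → π₁ <+: π₂ → π₁ = π₂

/-- `U` is a universal prefix-free machine with oracle `A`: it is a prefix-free machine with
oracle `A`, and for every such machine `M` there is a string `πM` with
`U (πM ++ σ) τ = M σ τ` for all `σ` and `τ` (as partial functions). Such a `U` exists for every
`A`: see `isUniversalMachine_universalMachine`. -/
structure IsUniversalMachine (A : Set (List Bool)) (U : List Bool → List Bool →. List Bool) :
    Prop extends IsPrefixFreeMachine A U where
  simulates : ∀ M, IsPrefixFreeMachine A M →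
    ∃ πM : List Bool, ∀ σ τ : List Bool, U (πM ++ σ) τ = M σ τ

/-- The Kolmogorov complexity `K(σ | τ)` of a string `σ` given a string `τ`, with respect to the
machine `U`: the least length of a program `π` with `U(π, τ) = σ`. -/
noncomputable def K (U : List Bool → List Bool →. List Bool) (σ τ : List Bool) : ℕ :=
  sInf {k | ∃ π : List Bool, σ ∈ U π τ ∧ π.length = k}

/-- A natural number coding a rational number (numerator and denominator). -/
def ratCode (q : ℚ) : ℕ := Nat.pair (Encodable.encode q.num) q.den

/-- The effective encoding of rational vectors (of all dimensions) by strings: the binary digits of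
the number that codes the list of the codes of the coordinates. -/
def ratVecCode {n : ℕ} (p : Fin n → ℚ) : List Bool :=
  (Encodable.encode (List.ofFn fun i => ratCode (p i))).bits

/-- `B(x, 2⁻ʳ) ∩ ℚⁿ`, for the Euclidean ball. -/
def ratBall {n : ℕ} (x : EuclideanSpace ℝ (Fin n)) (r : ℕ) : Set (Fin n → ℚ) :=
  {p | WithLp.toLp 2 (fun i => (p i : ℝ)) ∈ Metric.ball x ((2 : ℝ) ^ (-(r : ℤ)))}

/-- `K_r(x)`, the Kolmogorov complexity of the point `x` to precision `r`: the minimum of `K(p)`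
over the rational points `p` of `B(x, 2⁻ʳ)`. -/
noncomputable def Kpt (U : List Bool → List Bool →. List Bool) {n : ℕ} (r : ℕ)
    (x : EuclideanSpace ℝ (Fin n)) : ℕ :=
  sInf {k | ∃ p ∈ ratBall x r, K U (ratVecCode p) [] = k}

/-- `K_{r,s}(x | y)`, the Kolmogorov complexity of `x` to precision `r` given `y` to precision `s`:
the maximum, over the rational points `q` of `B(y, 2⁻ˢ)`, of the minimum of `K(p | q)` over the
rational points `p` of `B(x, 2⁻ʳ)`. -/
noncomputable def KptCond (U : List Bool → List Bool →. List Bool) {n m : ℕ} (r s : ℕ)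
    (x : EuclideanSpace ℝ (Fin n)) (y : EuclideanSpace ℝ (Fin m)) : ℕ :=
  sSup {k | ∃ q ∈ ratBall y s,
    sInf {l | ∃ p ∈ ratBall x r, K U (ratVecCode p) (ratVecCode q) = l} = k}

end Definitions

/- Sanity facts: universal prefix-free machines exist for every oracle, and the minima and
the maximum in the definitions above are attained. -/

section Existence

open Encodable

/-- The list of the first `k` values of `a`. -/
def initSeg (a : ℕ → ℕ) (k : ℕ) : List ℕ := (List.range k).map a

theorem initSeg_prefix (a : ℕ → ℕ) {j k : ℕ} (h : j ≤ k) : initSeg a j <+: initSeg a k := by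
  obtain ⟨d, rfl⟩ := Nat.exists_eq_add_of_le h
  refine ⟨(List.range d).map (fun i => a (j + i)), ?_⟩
  simp [initSeg, List.range_add, Function.comp_def]

theorem exists_approx (a : ℕ → ℕ) {f : ℕ →. ℕ} (hf : Nat.RecursiveIn {(a : ℕ →. ℕ)} f) :
    ∃ g : List ℕ → ℕ →. ℕ, Partrec₂ g ∧
      (∀ l l' n y, l <+: l' → y ∈ g l n → y ∈ g l' n) ∧
      ∀ n y, y ∈ f n ↔ ∃ k, y ∈ g (initSeg a k) n := by
  have base : ∀ f : ℕ →. ℕ, Nat.Partrec f → ∃ g : List ℕ → ℕ →. ℕ, Partrec₂ g ∧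
      (∀ l l' n y, l <+: l' → y ∈ g l n → y ∈ g l' n) ∧
      ∀ n y, y ∈ f n ↔ ∃ k, y ∈ g (initSeg a k) n := fun f hf =>
    ⟨fun _ n => f n, (Partrec.nat_iff.2 hf).comp Computable.snd, by simp, by simp⟩
  induction hf with
  | zero => exact base _ .zero
  | succ => exact base _ .succ
  | left => exact base _ .left
  | right => exact base _ .right
  | oracle g hg =>
    obtain rfl : g = a := hg
    refine ⟨fun l n => Part.ofOption (l[n]?), ?_, ?_, ?_⟩
    · exact Computable.ofOption Computable.list_getElem?
    · rintro l _ n y ⟨m, rfl⟩ h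
      simp only [Part.mem_ofOption, Option.mem_def, List.getElem?_eq_some_iff] at h ⊢
      obtain ⟨h1, rfl⟩ := h
      exact ⟨by simp; omega, by simp [List.getElem_append_left h1]⟩
    · intro n y
      simp only [Part.mem_ofOption, Option.mem_def, PFun.coe_val, Part.mem_some_iff, initSeg]
      constructor
      · rintro rfl
        exact ⟨n + 1, by simp⟩
      · rintro ⟨k, hk⟩
        simp [List.getElem?_eq_some_iff] at hk
        exact hk.2.symm
  | pair _ _ ih₁ ih₂ =>
    obtain ⟨g₁, p₁, m₁, s₁⟩ := ih₁
    obtain ⟨g₂, p₂, m₂, s₂⟩ := ih₂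
    refine ⟨fun l n => (g₁ l n).bind fun u => (g₂ l n).map fun v => Nat.pair u v, ?_, ?_, ?_⟩
    · refine Partrec.bind p₁ (Partrec.map (p₂.comp (Computable.fst.comp Computable.fst)
        (Computable.snd.comp Computable.fst)) ?_)
      exact (Primrec₂.natPair.to_comp).comp (Computable.snd.comp Computable.fst) Computable.snd
    · intro l l' n y hl
      simp only [Part.mem_bind_iff, Part.mem_map_iff]
      rintro ⟨u, hu, v, hv, rfl⟩
      exact ⟨u, m₁ _ _ _ _ hl hu, v, m₂ _ _ _ _ hl hv, rfl⟩
    · intro n y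
      simp only [Seq.seq, Part.map_eq_map, Part.bind_map, Part.mem_bind_iff, Part.mem_map_iff,
        s₁, s₂]
      constructor
      · rintro ⟨u, ⟨k, hu⟩, v, ⟨k', hv⟩, rfl⟩
        exact ⟨max k k', u, m₁ _ _ _ _ (initSeg_prefix a (le_max_left _ _)) hu, v,
          m₂ _ _ _ _ (initSeg_prefix a (le_max_right _ _)) hv, rfl⟩
      · rintro ⟨k, u, hu, v, hv, rfl⟩
        exact ⟨u, ⟨k, hu⟩, v, ⟨k, hv⟩, rfl⟩
  | @comp f h _ _ ih₁ ih₂ =>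
    obtain ⟨g₁, p₁, m₁, s₁⟩ := ih₁
    obtain ⟨g₂, p₂, m₂, s₂⟩ := ih₂
    refine ⟨fun l n => (g₂ l n).bind fun u => g₁ l u, ?_, ?_, ?_⟩
    · exact Partrec.bind p₂ (p₁.comp (Computable.fst.comp Computable.fst) Computable.snd)
    · intro l l' n y hl
      rw [Part.mem_bind_iff, Part.mem_bind_iff]
      rintro ⟨u, hu, hv⟩
      exact ⟨u, m₂ _ _ _ _ hl hu, m₁ _ _ _ _ hl hv⟩
    · intro n y
      refine Part.mem_bind_iff.trans ⟨?_, ?_⟩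
      · rintro ⟨u, hu, hv⟩
        obtain ⟨k, hu⟩ := (s₂ _ _).1 hu
        obtain ⟨k', hv⟩ := (s₁ _ _).1 hv
        exact ⟨max k k', Part.mem_bind_iff.2
          ⟨u, m₂ _ _ _ _ (initSeg_prefix a (le_max_left _ _)) hu,
            m₁ _ _ _ _ (initSeg_prefix a (le_max_right _ _)) hv⟩⟩
      · rintro ⟨k, h⟩
        obtain ⟨u, hu, hv⟩ := Part.mem_bind_iff.1 h
        exact ⟨u, (s₂ _ _).2 ⟨k, hu⟩, (s₁ _ _).2 ⟨k, hv⟩⟩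
  | prec _ _ ih₁ ih₂ =>
    obtain ⟨g₁, p₁, m₁, s₁⟩ := ih₁
    obtain ⟨g₂, p₂, m₂, s₂⟩ := ih₂
    refine ⟨fun l p => Nat.rec (motive := fun _ => Part ℕ) (g₁ l p.unpair.1)
      (fun i IH => IH.bind fun v => g₂ l (Nat.pair p.unpair.1 (Nat.pair i v))) p.unpair.2, ?_, ?_, ?_⟩
    · refine Partrec.nat_rec (f := fun q : List ℕ × ℕ => q.2.unpair.2)
        (g := fun q : List ℕ × ℕ => g₁ q.1 q.2.unpair.1)
        (h := fun (q : List ℕ × ℕ) (w : ℕ × ℕ) =>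
          g₂ q.1 (Nat.pair q.2.unpair.1 (Nat.pair w.1 w.2))) ?_ ?_ ?_
      · exact Computable.snd.comp (Computable.unpair.comp Computable.snd)
      · exact p₁.comp Computable.fst (Computable.fst.comp (Computable.unpair.comp Computable.snd))
      · refine p₂.comp (Computable.fst.comp Computable.fst) ?_
        refine Primrec₂.natPair.to_comp.comp
          (Computable.fst.comp (Computable.unpair.comp (Computable.snd.comp Computable.fst))) ?_
        exact Primrec₂.natPair.to_comp.comp (Computable.fst.comp Computable.snd)
          (Computable.snd.comp Computable.snd)
    · intro l l' p y hl
      beta_reduce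
      generalize p.unpair.2 = N
      induction N generalizing y with
      | zero => exact m₁ _ _ _ _ hl
      | succ N ih =>
        simp only [Part.mem_bind_iff]
        rintro ⟨v, hv, h⟩
        exact ⟨v, ih _ hv, m₂ _ _ _ _ hl h⟩
    · intro p y
      have mono : ∀ (N : ℕ) (y : ℕ) (l l' : List ℕ), l <+: l' →
          y ∈ Nat.rec (motive := fun _ => Part ℕ) (g₁ l p.unpair.1)
            (fun i IH => IH.bind fun v => g₂ l (Nat.pair p.unpair.1 (Nat.pair i v))) N →
          y ∈ Nat.rec (motive := fun _ => Part ℕ) (g₁ l' p.unpair.1)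
            (fun i IH => IH.bind fun v => g₂ l' (Nat.pair p.unpair.1 (Nat.pair i v))) N := by
        intro N
        induction N with
        | zero => exact fun y l l' hl => m₁ _ _ _ _ hl
        | succ N ih =>
          intro y l l' hl
          simp only [Part.mem_bind_iff]
          rintro ⟨v, hv, h⟩
          exact ⟨v, ih _ _ _ hl hv, m₂ _ _ _ _ hl h⟩
      simp only [Part.bind_eq_bind]
      generalize p.unpair.2 = N
      induction N generalizing y with
      | zero => exact s₁ _ _
      | succ N ih =>
        simp only [Part.mem_bind_iff, ih, s₂]
        constructor
        · rintro ⟨u, ⟨k, hu⟩, ⟨k', hv⟩⟩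
          exact ⟨max k k', u, mono _ _ _ _ (initSeg_prefix a (le_max_left _ _)) hu,
            m₂ _ _ _ _ (initSeg_prefix a (le_max_right _ _)) hv⟩
        · rintro ⟨k, u, hu, hv⟩
          exact ⟨u, ⟨k, hu⟩, ⟨k, hv⟩⟩
  | @rfind f _ ih =>
    obtain ⟨g, p, m, s⟩ := ih
    have key : ∀ (P : ℕ → Part ℕ) (y : ℕ),
        y ∈ Nat.rfind (fun n => (fun m => decide (m = 0)) <$> P n) ↔
          0 ∈ P y ∧ ∀ i < y, ∃ v, v ≠ 0 ∧ v ∈ P i := by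
      intro P y
      refine Nat.mem_rfind.trans ?_
      simp only [Part.map_eq_map, Part.mem_map_iff, decide_eq_true_eq, decide_eq_false_iff_not]
      constructor
      · rintro ⟨⟨v, hv, rfl⟩, h⟩
        refine ⟨hv, fun i hi => ?_⟩
        obtain ⟨v, hv, h0⟩ := h hi
        exact ⟨v, h0, hv⟩
      · rintro ⟨h0, h⟩
        refine ⟨⟨0, h0, rfl⟩, fun {i} hi => ?_⟩
        obtain ⟨v, hv, h0⟩ := h i hi
        exact ⟨v, h0, hv⟩
    refine ⟨fun l x => Nat.rfind fun n => (fun m => decide (m = 0)) <$> g l (Nat.pair x n),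
      ?_, ?_, ?_⟩
    · refine Partrec.rfind (p := fun (q : List ℕ × ℕ) (n : ℕ) =>
        ((g q.1 (Nat.pair q.2 n)).map fun m => decide (m = 0))) ?_
      refine Partrec.map (p.comp (Computable.fst.comp Computable.fst)
        (Primrec₂.natPair.to_comp.comp (Computable.snd.comp Computable.fst) Computable.snd)) ?_
      exact (Primrec.eq.decide.comp Primrec.snd (Primrec.const 0)).to_comp
    · intro l l' x y hl
      simp only [key]
      rintro ⟨h0, h⟩
      refine ⟨m _ _ _ _ hl h0, fun i hi => ?_⟩
      obtain ⟨v, hv, h1⟩ := h i hi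
      exact ⟨v, hv, m _ _ _ _ hl h1⟩
    · intro x y
      simp only [key, s]
      constructor
      · rintro ⟨⟨k, h0⟩, h⟩
        choose! v hv κ hκ using h
        refine ⟨max k ((Finset.range y).sup κ),
          m _ _ _ _ (initSeg_prefix a (le_max_left _ _)) h0, fun i hi => ⟨v i, hv i hi, ?_⟩⟩
        refine m _ _ _ _ (initSeg_prefix a (le_trans ?_ (le_max_right _ _))) (hκ i hi)
        exact Finset.le_sup (f := κ) (Finset.mem_range.2 hi)
      · rintro ⟨k, h0, h⟩
        refine ⟨⟨k, h0⟩, fun i hi => ?_⟩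
        obtain ⟨v, hv, h1⟩ := h i hi
        exact ⟨v, hv, k, h1⟩

theorem recursiveIn_initSeg (a : ℕ → ℕ) :
    Nat.RecursiveIn {(a : ℕ →. ℕ)} (fun k => Part.some (encode (initSeg a k))) := by
  have H : Nat.RecursiveIn {(a : ℕ →. ℕ)} (fun p : ℕ =>
      Part.some (encode (((decode (α := List ℕ) p.unpair.2).getD []) ++ [p.unpair.1]))) := by
    refine Nat.Partrec.recursiveIn (Partrec.nat_iff.1 (Computable.partrec ?_))
    refine Computable.encode.comp (Primrec.to_comp ?_)
    exact Primrec.list_concat.comp (Primrec.option_getD.comp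
      (Primrec.decode.comp (Primrec.snd.comp Primrec.unpair)) (Primrec.const []))
      (Primrec.fst.comp Primrec.unpair)
  have R := Nat.RecursiveIn.right (O := {(a : ℕ →. ℕ)})
  have Lf := Nat.RecursiveIn.left (O := {(a : ℕ →. ℕ)})
  have Z := Nat.RecursiveIn.zero (O := {(a : ℕ →. ℕ)})
  have Or := Nat.RecursiveIn.oracle (O := {(a : ℕ →. ℕ)}) (a : ℕ →. ℕ) rfl
  have P := Nat.RecursiveIn.prec Z (H.comp ((Or.comp (Lf.comp R)).pair (R.comp R)))
  have I : Nat.RecursiveIn {(a : ℕ →. ℕ)} (fun n => Part.some n) :=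
    (Nat.Partrec.some).recursiveIn
  refine (P.comp (Z.pair I)).of_eq fun n => ?_
  have e1 : (Nat.pair <$> (fun _ => (0 : Part ℕ)) n <*> (fun n => Part.some n) n) =
      Part.some (Nat.pair 0 n) := by
    show Nat.pair <$> (Part.some 0) <*> _ = _
    simp [Seq.seq]
  rw [e1, Part.bind_eq_bind, Part.bind_some]
  simp only [Nat.unpair_pair]
  clear e1
  induction n with
  | zero => rfl
  | succ n ih =>
    refine (congrArg (fun t : Part ℕ => t.bind _) ih).trans ?_
    have e2 : (Part.some n >>= (a : ℕ →. ℕ)) = Part.some (a n) := Part.bind_some _ _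
    simp [Seq.seq, initSeg, List.range_succ, e2]

/-- Unbounded search with a computable test that may consult longer and longer initial segments
of the values of `a` is recursive in `a`. -/
theorem recursiveIn_search (a : ℕ → ℕ) (G : List ℕ → ℕ → ℕ → Option ℕ)
    (hG : Computable fun p : List ℕ × ℕ × ℕ => G p.1 p.2.1 p.2.2) :
    Nat.RecursiveIn {(a : ℕ →. ℕ)}
      (fun n => Nat.rfindOpt fun j => G (initSeg a j) j n) := by
  have R := Nat.RecursiveIn.right (O := {(a : ℕ →. ℕ)})
  have I : Nat.RecursiveIn {(a : ℕ →. ℕ)} (fun n => Part.some n) :=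
    (Nat.Partrec.some).recursiveIn
  have hQ : Nat.RecursiveIn {(a : ℕ →. ℕ)} (fun p : ℕ =>
      Part.some (encode (G (initSeg a p.unpair.2) p.unpair.2 p.unpair.1))) := by
    have hC : Nat.RecursiveIn {(a : ℕ →. ℕ)} (fun p : ℕ => Part.some (encode
        (G ((decode (α := List ℕ) p.unpair.1).getD []) p.unpair.2.unpair.2
          p.unpair.2.unpair.1))) := by
      refine Nat.Partrec.recursiveIn (Partrec.nat_iff.1 (Computable.partrec ?_))
      have h2 := Primrec.unpair.comp (Primrec.snd.comp Primrec.unpair)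
      refine Computable.encode.comp (hG.comp (Primrec.to_comp (f := fun p : ℕ =>
        (((decode (α := List ℕ) p.unpair.1).getD []), p.unpair.2.unpair.2,
          p.unpair.2.unpair.1)) ?_))
      exact (Primrec.option_getD.comp
        (Primrec.decode.comp (Primrec.fst.comp Primrec.unpair)) (Primrec.const [])).pair
        ((Primrec.snd.comp h2).pair (Primrec.fst.comp h2))
    refine (hC.comp (((recursiveIn_initSeg a).comp R).pair I)).of_eq fun p => ?_
    simp [Seq.seq]
  have hT : Nat.RecursiveIn {(a : ℕ →. ℕ)} (fun p : ℕ => Part.some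
      (if (G (initSeg a p.unpair.2) p.unpair.2 p.unpair.1).isSome then 0 else 1)) := by
    have hC : Nat.RecursiveIn {(a : ℕ →. ℕ)} (fun m : ℕ => Part.some (1 - m)) :=
      Nat.Partrec.recursiveIn (Partrec.nat_iff.1 (Computable.partrec
        (Primrec.nat_sub.comp (Primrec.const 1) Primrec.id).to_comp))
    refine (hC.comp hQ).of_eq fun p => ?_
    rw [Part.bind_eq_bind, Part.bind_some]
    cases G (initSeg a p.unpair.2) p.unpair.2 p.unpair.1 <;> simp
  have hE : Nat.RecursiveIn {(a : ℕ →. ℕ)} (fun m : ℕ =>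
      (Part.ofOption ((decode (α := Option ℕ) m).getD none))) :=
    Nat.Partrec.recursiveIn (Partrec.nat_iff.1 (Computable.ofOption
      (Primrec.option_getD.comp Primrec.decode (Primrec.const none)).to_comp))
  refine (hE.comp (hQ.comp (I.pair hT.rfind))).of_eq fun n => ?_
  have e1 : (Nat.rfind fun k => (fun m => decide (m = 0)) <$>
      (Part.some (if (G (initSeg a (Nat.pair n k).unpair.2) (Nat.pair n k).unpair.2
        (Nat.pair n k).unpair.1).isSome then 0 else 1) : Part ℕ)) =
      Nat.rfind fun k => Part.some (G (initSeg a k) k n).isSome := by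
    congr 1
    funext k
    cases h : G (initSeg a k) k n <;> simp [h]
  simp only [Seq.seq, Part.bind_eq_bind, Part.map_eq_map, Part.map_some, Part.bind_some]
  simp only [Part.map_eq_map, Part.map_some] at e1
  erw [e1]
  simp [Nat.rfindOpt, Part.bind_map, Part.bind_assoc]

def universalTest (l : List ℕ) (j : ℕ) (p : List Bool × List Bool) : Option (Option (List Bool)) :=
  let e := p.1.idxOf false
  let σ := p.1.drop (e + 1)
  let σ' := (decode (α := List Bool) j.unpair.2.unpair.2).getD []
  if e < p.1.length ∧ σ'.take σ.length = σ.take σ'.length then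
    (Nat.Partrec.Code.evaln j.unpair.2.unpair.1 (Denumerable.ofNat Nat.Partrec.Code e)
      (encode (l.take j.unpair.1, encode (σ', p.2)))).map
        fun v => if σ' = σ then decode (α := List Bool) v else none
  else none

theorem computable_universalTest :
    Computable fun q : List ℕ × ℕ × (List Bool × List Bool) =>
      universalTest q.1 q.2.1 q.2.2 := by
  refine Primrec.to_comp ?_
  have hl : Primrec fun q : List ℕ × ℕ × (List Bool × List Bool) => q.1 := Primrec.fst
  have hj : Primrec fun q : List ℕ × ℕ × (List Bool × List Bool) => q.2.1 :=
    Primrec.fst.comp Primrec.snd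
  have hπ : Primrec fun q : List ℕ × ℕ × (List Bool × List Bool) => q.2.2.1 :=
    Primrec.fst.comp (Primrec.snd.comp Primrec.snd)
  have hτ : Primrec fun q : List ℕ × ℕ × (List Bool × List Bool) => q.2.2.2 :=
    Primrec.snd.comp (Primrec.snd.comp Primrec.snd)
  have he : Primrec fun q : List ℕ × ℕ × (List Bool × List Bool) => q.2.2.1.idxOf false :=
    Primrec.list_idxOf.comp (Primrec.const false) hπ
  have hσ := Primrec.list_drop.comp (Primrec.succ.comp he) hπ
  have hk := Primrec.fst.comp (Primrec.unpair.comp hj)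
  have hj2 := Primrec.unpair.comp (Primrec.snd.comp (Primrec.unpair.comp hj))
  have hs := Primrec.fst.comp hj2
  have hσ' := Primrec.option_getD.comp
    ((Primrec.decode (α := List Bool)).comp (Primrec.snd.comp hj2)) (Primrec.const [])
  refine Primrec.ite (PrimrecPred.and (Primrec.nat_lt.comp he (Primrec.list_length.comp hπ))
    (Primrec.eq.comp (Primrec.list_take.comp (Primrec.list_length.comp hσ) hσ')
      (Primrec.list_take.comp (Primrec.list_length.comp hσ') hσ))) ?_ (Primrec.const none)
  refine Primrec.option_map (Nat.Partrec.Code.primrec_evaln.comp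
    ((hs.pair ((Primrec.ofNat _).comp he)).pair (Primrec.encode.comp
      ((Primrec.list_take.comp hk hl).pair (Primrec.encode.comp (hσ'.pair hτ)))))) ?_
  exact Primrec.ite (Primrec.eq.comp (hσ'.comp Primrec.fst) (hσ.comp Primrec.fst))
    (Primrec.decode.comp Primrec.snd) (Primrec.const none)

/-- A concrete universal prefix-free machine with oracle `A`. -/
noncomputable def universalMachine (A : Set (List Bool)) : List Bool → List Bool →. List Bool :=
  fun π τ => (Nat.rfindOpt fun j =>
    universalTest (initSeg (oracleChar A) j) j (π, τ)).bind fun o => Part.ofOption o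

theorem mem_rfindOpt_iff {α : Type*} (f : ℕ → Option α) (y : α) :
    y ∈ Nat.rfindOpt f ↔ ∃ j, f j = some y ∧ ∀ i < j, f i = none := by
  simp only [Nat.rfindOpt, Part.mem_bind_iff, Part.mem_ofOption, Option.mem_def]
  constructor
  · rintro ⟨j, hj, h⟩
    refine ⟨j, h, fun i hi => ?_⟩
    simpa using Nat.rfind_min hj hi
  · rintro ⟨j, h, hj⟩
    refine ⟨j, Nat.mem_rfind.2 ⟨?_, fun {i} hi => ?_⟩, h⟩
    · simp [h]
    · simp [hj i hi]

theorem mem_universalMachine {A : Set (List Bool)} {π τ y : List Bool} :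
    y ∈ universalMachine A π τ ↔
      ∃ j, universalTest (initSeg (oracleChar A) j) j (π, τ) = some (some y) ∧
        ∀ i < j, universalTest (initSeg (oracleChar A) i) i (π, τ) = none := by
  simp only [universalMachine]
  refine Part.mem_bind_iff.trans ?_
  simp only [mem_rfindOpt_iff, Part.mem_ofOption, Option.mem_def]
  constructor
  · rintro ⟨_, h, rfl⟩
    exact h
  · exact fun h => ⟨_, h, rfl⟩

theorem take_eq_take_iff {σ σ' : List Bool} :
    σ'.take σ.length = σ.take σ'.length ↔ σ <+: σ' ∨ σ' <+: σ := by
  constructor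
  · intro h
    rcases le_total σ.length σ'.length with hl | hl
    · rw [List.take_of_length_le hl] at h
      exact Or.inl (h ▸ List.take_prefix _ _)
    · rw [List.take_of_length_le hl] at h
      exact Or.inr (h ▸ List.take_prefix _ _)
  · rintro (⟨ρ, rfl⟩ | ⟨ρ, rfl⟩) <;> simp

theorem universalTest_isSome {l : List ℕ} {j : ℕ} {π τ : List Bool} {o : Option (List Bool)} :
    universalTest l j (π, τ) = some o ↔
      π.idxOf false < π.length ∧ ∃ σ' v : _, σ' = (decode (α := List Bool) j.unpair.2.unpair.2).getD [] ∧
        (π.drop (π.idxOf false + 1) <+: σ' ∨ σ' <+: π.drop (π.idxOf false + 1)) ∧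
        Nat.Partrec.Code.evaln j.unpair.2.unpair.1
          (Denumerable.ofNat Nat.Partrec.Code (π.idxOf false))
          (encode (l.take j.unpair.1, encode (σ', τ))) = some v ∧
        o = if σ' = π.drop (π.idxOf false + 1) then decode (α := List Bool) v else none := by
  simp only [universalTest, take_eq_take_iff]
  constructor
  · intro h
    split at h
    · next hc =>
      obtain ⟨v, hv, rfl⟩ := Option.map_eq_some_iff.1 h
      exact ⟨hc.1, _, v, rfl, hc.2, hv, rfl⟩
    · exact absurd h (by simp)
  · rintro ⟨h1, _, v, rfl, h2, hv, rfl⟩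
    rw [if_pos ⟨h1, h2⟩, hv]
    rfl

theorem computable_universalTest_nat :
    Computable fun q : List ℕ × ℕ × ℕ =>
      (decode (α := List Bool × List Bool) q.2.2).bind fun p =>
        (universalTest q.1 q.2.1 p).map encode := by
  have h1 : Computable fun q : List ℕ × ℕ × ℕ => decode (α := List Bool × List Bool) q.2.2 :=
    Computable.decode.comp (Computable.snd.comp Computable.snd)
  have h2 : Computable fun z : (List ℕ × ℕ × ℕ) × (List Bool × List Bool) =>
      universalTest z.1.1 z.1.2.1 z.2 :=
    computable_universalTest.comp (g := fun z : (List ℕ × ℕ × ℕ) × (List Bool × List Bool) =>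
      (z.1.1, z.1.2.1, z.2)) ((Computable.fst.comp Computable.fst).pair
        ((Computable.fst.comp (Computable.snd.comp Computable.fst)).pair Computable.snd))
  have h3 : Computable fun z : (List ℕ × ℕ × ℕ) × (List Bool × List Bool) =>
      (universalTest z.1.1 z.1.2.1 z.2).map encode :=
    Computable.option_map h2 (Computable.encode.comp Computable.snd).to₂
  exact Computable.option_bind h1 h3.to₂

theorem recursive_universalMachine (A : Set (List Bool)) :
    RecursiveIn₂ {(oracleChar A : ℕ →. ℕ)} (universalMachine A) := by
  have h := recursiveIn_search (oracleChar A)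
    (fun l j n => (decode (α := List Bool × List Bool) n).bind fun p =>
      (universalTest l j p).map encode) computable_universalTest_nat
  have hE : Nat.RecursiveIn {(oracleChar A : ℕ →. ℕ)} (fun m : ℕ =>
      (Part.ofOption ((decode (α := Option (List Bool)) m).getD none)).map encode) := by
    refine Nat.Partrec.recursiveIn (Partrec.nat_iff.1 (Partrec.map (Computable.ofOption
      (Primrec.option_getD.comp Primrec.decode (Primrec.const none)).to_comp) ?_))
    exact (Computable.encode.comp Computable.snd).to₂
  refine (hE.comp h).of_eq fun n => ?_
  refine Part.ext fun y => ?_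
  refine Part.mem_bind_iff.trans (Iff.trans ?_ Part.mem_bind_iff.symm)
  simp only [mem_rfindOpt_iff]
  cases hn : decode (α := List Bool × List Bool) n with
  | none => simp
  | some p =>
    obtain ⟨π, τ⟩ := p
    simp only [Option.bind_some, Option.map_eq_some_iff, Option.map_eq_none_iff,
      Part.mem_map_iff, Part.mem_ofOption, Option.mem_def, Part.coe_some, Part.mem_some_iff,
      exists_eq_left, mem_universalMachine]
    constructor
    · rintro ⟨m, ⟨j, ⟨o, ho, rfl⟩, hj⟩, y, hy, rfl⟩
      simp only [encodek, Option.getD_some] at hy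
      subst hy
      exact ⟨y, ⟨j, ho, hj⟩, rfl⟩
    · rintro ⟨y, ⟨j, ho, hj⟩, rfl⟩
      exact ⟨_, ⟨j, ⟨_, ho, rfl⟩, hj⟩, y, by simp, rfl⟩

theorem isUniversalMachine_universalMachine (A : Set (List Bool)) :
    IsUniversalMachine A (universalMachine A) where
  recursive := recursive_universalMachine A
  prefixFree := by
    intro τ π₁ π₂ h₁ h₂ hp
    obtain ⟨y₁, h₁⟩ := Part.dom_iff_mem.1 h₁
    obtain ⟨y₂, h₂⟩ := Part.dom_iff_mem.1 h₂
    obtain ⟨j₁, h₁, m₁⟩ := mem_universalMachine.1 h₁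
    obtain ⟨j₂, h₂, m₂⟩ := mem_universalMachine.1 h₂
    obtain ⟨l₁, s₁, v₁, e₁, c₁, t₁, o₁⟩ := universalTest_isSome.1 h₁
    obtain ⟨l₂, s₂, v₂, e₂, c₂, t₂, o₂⟩ := universalTest_isSome.1 h₂
    have q₁ : s₁ = π₁.drop (π₁.idxOf false + 1) := by
      by_contra h; simp [h] at o₁
    have q₂ : s₂ = π₂.drop (π₂.idxOf false + 1) := by
      by_contra h; simp [h] at o₂
    obtain ⟨ρ, rfl⟩ := hp
    have hi : (π₁ ++ ρ).idxOf false = π₁.idxOf false :=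
      List.idxOf_append_of_mem (List.idxOf_lt_length_iff.1 l₁)
    have hd : (π₁ ++ ρ).drop (π₁.idxOf false + 1) = π₁.drop (π₁.idxOf false + 1) ++ ρ :=
      List.drop_append_of_le_length l₁
    rw [hi] at l₂ c₂ t₂ q₂
    rw [hd] at q₂ c₂
    have n₁ : universalTest (initSeg (oracleChar A) j₁) j₁ (π₁ ++ ρ, τ) ≠ none := by
      rw [Option.ne_none_iff_exists']
      refine ⟨_, universalTest_isSome.2 ⟨by rwa [hi], s₁, v₁, e₁, ?_, by rwa [hi], rfl⟩⟩
      rw [hi, hd, q₁]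
      exact Or.inr ⟨ρ, rfl⟩
    have n₂ : universalTest (initSeg (oracleChar A) j₂) j₂ (π₁, τ) ≠ none := by
      rw [Option.ne_none_iff_exists']
      refine ⟨_, universalTest_isSome.2 ⟨l₁, s₂, v₂, e₂, ?_, t₂, rfl⟩⟩
      rw [q₂]
      exact Or.inl ⟨ρ, rfl⟩
    have hj : j₁ = j₂ := le_antisymm (not_lt.1 fun h => n₂ (m₁ _ h))
      (not_lt.1 fun h => n₁ (m₂ _ h))
    subst hj
    have : s₁ = s₂ := e₁.trans e₂.symm
    rw [q₁, q₂] at this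
    simpa using this
  simulates := by
    intro M hM
    obtain ⟨g, hg, mono, spec⟩ := exists_approx (oracleChar A) hM.recursive
    obtain ⟨c, hc⟩ := Nat.Partrec.Code.exists_code.1 hg
    have hc' : ∀ l m, Nat.Partrec.Code.eval c (encode (l, m)) = g l m := by
      intro l m
      rw [hc]
      simp [Part.map_id']
    have hspec : ∀ σ τ v, (∃ k, v ∈ g (initSeg (oracleChar A) k) (encode (σ, τ))) ↔
        ∃ y ∈ M σ τ, encode y = v := by
      intro σ τ v
      rw [← spec]
      simp [Part.mem_map_iff]
    refine ⟨List.replicate (encode c) true ++ [false], fun σ τ => ?_⟩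
    set π := List.replicate (encode c) true ++ [false] ++ σ with hπ
    have hi : π.idxOf false = encode c := by
      rw [hπ, List.append_assoc, List.idxOf_append_of_notMem (by simp [List.mem_replicate])]
      simp
    have hd : π.drop (encode c + 1) = σ := by
      rw [hπ, List.drop_append_of_le_length (by simp)]
      simp
    have hlen : π.idxOf false < π.length := by rw [hi, hπ]; simp
    have htake : ∀ j, (initSeg (oracleChar A) j).take j.unpair.1 =
        initSeg (oracleChar A) j.unpair.1 := by
      intro j
      simp [initSeg, ← List.map_take, List.take_range, Nat.unpair_left_le]
    have sound : ∀ j o, universalTest (initSeg (oracleChar A) j) j (π, τ) = some o →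
        (o.isSome ∨ (M σ τ).Dom) → ∃ y ∈ M σ τ, o = some y := by
      intro j o h hor
      obtain ⟨-, σ', v, -, hcmp, hv, ho⟩ := universalTest_isSome.1 h
      rw [hi, hd] at hcmp
      rw [hi, hd] at ho
      rw [hi, Denumerable.ofNat_encode, htake] at hv
      have hv' := Nat.Partrec.Code.evaln_sound hv
      rw [hc'] at hv'
      obtain ⟨y, hy, rfl⟩ := (hspec σ' τ v).1 ⟨_, hv'⟩
      have hdom : (M σ' τ).Dom := Part.dom_iff_mem.2 ⟨y, hy⟩
      have hs : σ' = σ := by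
        rcases hor with hor | hσ
        · by_contra hne
          simp [hne] at ho
          simp [ho] at hor
        · rcases hcmp with h | h
          · exact (hM.prefixFree τ _ _ hσ hdom h).symm
          · exact hM.prefixFree τ _ _ hdom hσ h
      subst hs
      exact ⟨y, hy, by simpa using ho⟩
    refine Part.ext fun y => mem_universalMachine.trans ⟨?_, fun hy => ?_⟩
    · rintro ⟨j, hj, -⟩
      obtain ⟨z, hz, h⟩ := sound j _ hj (Or.inl rfl)
      exact Option.some_injective _ h ▸ hz
    · have hdom : (M σ τ).Dom := Part.dom_iff_mem.2 ⟨y, hy⟩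
      obtain ⟨k, hk⟩ := (hspec σ τ (encode y)).2 ⟨y, hy, rfl⟩
      rw [← hc'] at hk
      obtain ⟨s, hs⟩ := Nat.Partrec.Code.evaln_complete.1 hk
      have hex : ∃ j o, universalTest (initSeg (oracleChar A) j) j (π, τ) = some o := by
        refine ⟨Nat.pair k (Nat.pair s (encode σ)), _,
          universalTest_isSome.2 ⟨hlen, σ, encode y, by simp, ?_, ?_, rfl⟩⟩
        · rw [hi, hd]
          exact Or.inl (List.prefix_refl σ)
        · rw [hi, Denumerable.ofNat_encode, htake]
          simpa using hs
      classical
      obtain ⟨o, ho⟩ := Nat.find_spec hex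
      obtain ⟨z, hz, rfl⟩ := sound _ _ ho (Or.inr hdom)
      obtain rfl := Part.mem_unique hz hy
      refine ⟨_, ho, fun i hi => ?_⟩
      by_contra hne
      exact Nat.find_min hex hi (Option.ne_none_iff_exists'.1 hne)

end Existence

section WellDefined

open Encodable

theorem IsPrefixFreeMachine.const (A : Set (List Bool)) (σ : List Bool) :
    IsPrefixFreeMachine A (fun π _ => if π = [] then Part.some σ else Part.none) where
  recursive := by
    refine Partrec.recursiveIn ?_
    refine (Computable.ofOption (f := fun p : List Bool × List Bool =>
      if p.1 = [] then some σ else none) ?_).of_eq fun p => ?_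
    · exact (Primrec.ite (Primrec.eq.comp Primrec.fst (Primrec.const [])) (Primrec.const _)
        (Primrec.const _)).to_comp
    · by_cases h : p.1 = [] <;> simp [h]
  prefixFree := by
    intro τ π₁ π₂ h₁ h₂ _
    have e : ∀ π : List Bool, (if π = [] then Part.some σ else Part.none).Dom → π = [] := by
      intro π h
      by_contra hne
      simp [hne] at h
    rw [e _ h₁, e _ h₂]

theorem IsPrefixFreeMachine.ignore {A : Set (List Bool)} {M : List Bool → List Bool →. List Bool}
    (hM : IsPrefixFreeMachine A M) : IsPrefixFreeMachine A (fun π _ => M π []) where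
  recursive := by
    have h : Nat.RecursiveIn {(oracleChar A : ℕ →. ℕ)} (fun n : ℕ => Part.ofOption
        ((decode (α := List Bool × List Bool) n).map fun p => encode (p.1, ([] : List Bool)))) := by
      refine Nat.Partrec.recursiveIn (Partrec.nat_iff.1 (Computable.ofOption
        (Primrec.option_map Primrec.decode ?_).to_comp))
      exact (Primrec.encode.comp ((Primrec.fst.comp Primrec.snd).pair (Primrec.const []))).to₂
    refine (Nat.RecursiveIn.comp hM.recursive h).of_eq fun n => ?_
    refine Part.ext fun y => ?_
    refine Part.mem_bind_iff.trans ?_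
    cases hn : decode (α := List Bool × List Bool) n <;> simp
  prefixFree := fun _ => hM.prefixFree []

theorem IsUniversalMachine.exists_program {A : Set (List Bool)}
    {U : List Bool → List Bool →. List Bool} (hU : IsUniversalMachine A U) (σ τ : List Bool) :
    ∃ π : List Bool, σ ∈ U π τ := by
  obtain ⟨πM, h⟩ := hU.simulates _ (IsPrefixFreeMachine.const A σ)
  exact ⟨πM ++ [], by rw [h]; simp⟩

/-- The minimum in the definition of `K` is attained. -/
theorem IsUniversalMachine.exists_length_eq_K {A : Set (List Bool)}
    {U : List Bool → List Bool →. List Bool} (hU : IsUniversalMachine A U) (σ τ : List Bool) :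
    ∃ π : List Bool, σ ∈ U π τ ∧ π.length = K U σ τ := by
  obtain ⟨π, h⟩ := hU.exists_program σ τ
  exact Nat.sInf_mem (s := {k | ∃ π : List Bool, σ ∈ U π τ ∧ π.length = k}) ⟨_, π, h, rfl⟩

/-- The encoding of rational vectors by strings is injective, across all dimensions. -/
theorem ratVecCode_injective :
    Function.Injective fun p : (Σ n : ℕ, Fin n → ℚ) => ratVecCode p.2 := by
  have h1 : Function.Injective ratCode := by
    intro q q' h
    simp only [ratCode, Nat.pair_eq_pair, Encodable.encode_inj] at h
    exact Rat.ext h.1 h.2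
  have h2 : Function.Injective Nat.bits := by
    intro a b h
    have e : ∀ k : ℕ, Nat.ofDigits 2 (k.bits.map fun c => cond c 1 0) = k := fun k => by
      rw [← Nat.digits_two_eq_bits, Nat.ofDigits_digits]
    rw [← e a, ← e b, h]
  rintro ⟨n, p⟩ ⟨m, q⟩ h
  have h3 := Encodable.encode_injective (h2 h)
  obtain rfl : n = m := by simpa using congrArg List.length h3
  have h4 := List.ofFn_injective h3
  have h5 : p = q := funext fun i => h1 (congrFun h4 i)
  rw [h5]

theorem ratBall_nonempty {n : ℕ} (x : EuclideanSpace ℝ (Fin n)) (r : ℕ) :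
    (ratBall x r).Nonempty := by
  have hd : DenseRange (fun p : Fin n → ℚ => fun i => (p i : ℝ)) :=
    DenseRange.piMap fun _ => Rat.denseRange_cast
  have ho : IsOpen ((WithLp.toLp 2) ⁻¹' (Metric.ball x ((2 : ℝ) ^ (-(r : ℤ)))) :
      Set (Fin n → ℝ)) :=
    Metric.isOpen_ball.preimage (PiLp.continuous_toLp 2 _)
  exact hd.exists_mem_open ho ⟨WithLp.ofLp x, by
    simp only [Set.mem_preimage, WithLp.toLp_ofLp]
    exact Metric.mem_ball_self (by positivity)⟩

/-- The set over which the maximum in the definition of `KptCond` is taken is bounded (and it is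
nonempty, by `ratBall_nonempty`). -/
theorem IsUniversalMachine.bddAbove_KptCond {A : Set (List Bool)}
    {U : List Bool → List Bool →. List Bool} (hU : IsUniversalMachine A U) {n m : ℕ} (r s : ℕ)
    (x : EuclideanSpace ℝ (Fin n)) (y : EuclideanSpace ℝ (Fin m)) :
    BddAbove {k | ∃ q ∈ ratBall y s,
      sInf {l | ∃ p ∈ ratBall x r, K U (ratVecCode p) (ratVecCode q) = l} = k} := by
  obtain ⟨πM, h⟩ := hU.simulates _ hU.toIsPrefixFreeMachine.ignore
  obtain ⟨p, hp⟩ := ratBall_nonempty x r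
  obtain ⟨π, hπ⟩ := hU.exists_program (ratVecCode p) []
  refine ⟨(πM ++ π).length, ?_⟩
  rintro _ ⟨q, -, rfl⟩
  refine le_trans (b := K U (ratVecCode p) (ratVecCode q)) (Nat.sInf_le ⟨p, hp, rfl⟩)
    (Nat.sInf_le ⟨πM ++ π, ?_, rfl⟩)
  rw [h]
  exact hπ

end WellDefined

end AlgInfo

/-! The point `x` stores, in its binary digits, the most economical step-by-step description of `y`.
Let `p_k` be the grid point approximating `y` to precision `k²`, and let `π_k` be a shortest program
that computes `p_(k+1)` from `p_k`. The digits of `π_0 π_1 π_2 …` define a real `X`, and the dense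
set consists of the points `(D + X) / 2 ^ h` with `D` an integer and `h` a natural number.

The stored description is nearly optimal at every precision. Since `p_k` is computable from
`p_(k+1)` and `k`, the hard half of the chain rule (`K_add_K_le`) gives `K(p_(k+1) | p_k) + K(p_k) ≤
K(p_(k+1)) + O(log k)`. Telescoping, the first `k` programs have total length `ℓ ≤ K(p_k) + O(k log
k)`. If `k²` exceeds `r` by `O(k)`, then `K(p_k)` is `K_r(y)` up to `O(k)`, so `ℓ ≤ K_r(y) + O(k log
k)` (`sum_gridKStep_le`). Squares serve as precisions because there are then only about `√r`
applications of the chain rule up to precision `r`, while consecutive precisions still differ by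
only `O(√r)`; both errors are `o(r)`.

The digits can be read from `x`. A rational `q` within `2 ^ (-r)` of `x` leaves at most `2 ^ (ℓ - r
+ O(1))` candidates for the first `ℓ` digits of `X` (truncated subtraction). Prefix-freeness makes a
concatenation of `k` programs uniquely decodable, so each candidate yields at most one end point,
and all these end points can be enumerated from `q` with oracle `A`. The position of `p_k` in that
enumeration describes it (`K_le_of_enumerable`, `K_le_of_isChain`), whence `K_r(y | x) ≤ max(K_r(y)
- r, 0) + O(√r log r)`, and the error is eventually below `ε r`. The constants depend on `D` and
`h`, so the threshold depends on `x`. -/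

namespace AlgInfo

open Encodable

/-! ### Binary strings as numbers. -/

section Strings

/-- The natural number with the given binary digits, least significant digit first. -/
def natOfBits (b : List Bool) : ℕ := b.foldr Nat.bit 0

@[simp] theorem natOfBits_nil : natOfBits [] = 0 := rfl

@[simp] theorem natOfBits_cons (c : Bool) (b : List Bool) :
    natOfBits (c :: b) = Nat.bit c (natOfBits b) := rfl

theorem natOfBits_append (b b' : List Bool) :
    natOfBits (b ++ b') = natOfBits b + 2 ^ b.length * natOfBits b' := by
  induction b with
  | nil => simp
  | cons c b ih =>
    simp only [List.cons_append, natOfBits_cons, ih, List.length_cons, pow_succ, Nat.bit_val]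
    ring

theorem natOfBits_lt (b : List Bool) : natOfBits b < 2 ^ b.length := by
  induction b with
  | nil => simp
  | cons c b ih =>
    simp only [natOfBits_cons, List.length_cons, pow_succ, Nat.bit_val]
    have := Bool.toNat_le c
    omega

theorem natOfBits_bits (m : ℕ) : natOfBits m.bits = m := by
  induction m using Nat.binaryRec' with
  | zero => simp
  | bit c m h ih => rw [Nat.bits_append_bit m c h, natOfBits_cons, ih]

theorem natOfBits_injOn {b b' : List Bool} (hl : b.length = b'.length)
    (h : natOfBits b = natOfBits b') : b = b' := by
  induction b generalizing b' with
  | nil => exact (List.length_eq_zero_iff.1 hl.symm).symm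
  | cons c b ih =>
    cases b' with
    | nil => simp at hl
    | cons c' b' =>
      simp only [natOfBits_cons, Nat.bit_val] at h
      have e : b = b' := ih (by simpa using hl) (by cases c <;> cases c' <;> simp at h <;> omega)
      subst e
      cases c <;> cases c' <;> simp at h ⊢

/-- Zeros appended at the most significant end give an index a representation of prescribed length,
as needed for the payload of a program. -/
theorem exists_natOfBits_eq {m L : ℕ} (h : m < 2 ^ L) :
    ∃ b : List Bool, b.length = L ∧ natOfBits b = m := by
  have hs : m.bits.length ≤ L := by
    rw [Nat.size_eq_bits_len]
    exact Nat.size_le.2 h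
  refine ⟨m.bits ++ List.replicate (L - m.bits.length) false, by simp; omega, ?_⟩
  have h0 : ∀ k, natOfBits (List.replicate k false) = 0 := by
    intro k
    induction k with
    | zero => rfl
    | succ k ih => simp [List.replicate_succ, ih]
  rw [natOfBits_append, h0, natOfBits_bits]
  simp

theorem primrec_natOfBits : Primrec natOfBits := by
  have h : Primrec fun q : List Bool × Bool × ℕ => Nat.bit q.2.1 q.2.2 := by
    refine (Primrec.cond (Primrec.fst.comp Primrec.snd)
      (Primrec.nat_double_succ.comp (Primrec.snd.comp Primrec.snd))
      (Primrec.nat_double.comp (Primrec.snd.comp Primrec.snd))).of_eq fun q => ?_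
    cases q.2.1 <;> simp
  exact Primrec.list_foldr Primrec.id (Primrec.const 0) h.to₂

theorem primrec_bits : Primrec Nat.bits := by
  have h : Primrec₂ fun (_ : Unit) (m : ℕ) => m.bits := by
    -- Course-of-values recursion: `IH` lists the digits of all smaller numbers, so its length is
    -- the current argument, and the digits of its half are prefixed by its parity.
    refine Primrec.nat_strong_rec _ (g := fun _ IH => if IH.length = 0 then some [] else
      (IH[IH.length.div2]?).map fun b => IH.length.bodd :: b) ?_ fun _ m => ?_
    · have hn : Primrec fun q : Unit × List (List Bool) => q.2.length :=
        Primrec.list_length.comp Primrec.snd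
      refine Primrec.ite (Primrec.eq.comp hn (Primrec.const 0)) (Primrec.const _) ?_
      refine Primrec.option_map
        (Primrec.list_getElem?.comp Primrec.snd (Primrec.nat_div2.comp hn)) ?_
      exact (Primrec.list_cons.comp (Primrec.nat_bodd.comp (hn.comp Primrec.fst))
        Primrec.snd).to₂
    · simp only [List.length_map, List.length_range]
      split_ifs with hm
      · simp [hm]
      · have hd : m.div2 < m := by rw [Nat.div2_val]; omega
        have hb : Nat.bit m.bodd m.div2 = m := Nat.bit_bodd_div2 m
        rw [List.getElem?_map, List.getElem?_range hd]
        simp only [Option.map_some, Option.some.injEq]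
        conv_rhs => rw [← hb]
        rw [Nat.bits_append_bit]
        intro h0
        by_contra hc
        rw [h0] at hb
        rw [Bool.not_eq_true] at hc
        rw [hc] at hb
        exact hm (by simpa using hb.symm)
  exact h.comp (Primrec.const ()) Primrec.id

end Strings

/-! ### Enumerations without repetitions. -/

section Collect

variable {α : Type*} [DecidableEq α]

/-- The elements of a list without repetitions, in the order of their first occurrence. -/
def collect (l : List α) : List α :=
  l.foldl (fun acc x => if x ∈ acc then acc else acc ++ [x]) []

theorem collect_concat (l : List α) (x : α) :
    collect (l ++ [x]) = if x ∈ collect l then collect l else collect l ++ [x] := by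
  rw [collect, List.foldl_concat]
  rfl

theorem mem_collect {l : List α} {x : α} : x ∈ collect l ↔ x ∈ l := by
  induction l using List.reverseRecOn generalizing x with
  | nil => simp [collect]
  | append_singleton l y ih =>
    rw [collect_concat]
    split_ifs with h
    · rw [ih, List.mem_append, List.mem_singleton]
      refine ⟨Or.inl, ?_⟩
      rintro (h' | rfl)
      · exact h'
      · exact ih.1 h
    · simp [ih]

theorem nodup_collect (l : List α) : (collect l).Nodup := by
  induction l using List.reverseRecOn with
  | nil => simp [collect]
  | append_singleton l y ih =>
    rw [collect_concat]
    split_ifs with h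
    · exact ih
    · exact List.nodup_append.2 ⟨ih, by simp, fun a ha b hb => by
        rintro rfl
        exact h (List.mem_singleton.1 hb ▸ ha)⟩

/-- New elements are only added at the end, so the position of an element in an enumeration never
changes and can serve as its description. -/
theorem collect_prefix {l l' : List α} (h : l <+: l') : collect l <+: collect l' := by
  obtain ⟨m, rfl⟩ := h
  induction m using List.reverseRecOn with
  | nil => simp
  | append_singleton m y ih =>
    rw [← List.append_assoc, collect_concat]
    split_ifs with h
    · exact ih
    · exact ih.trans (List.prefix_append _ _)

theorem primrec_collect {α : Type*} [DecidableEq α] [Primcodable α] :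
    Primrec (collect : List α → List α) := by
  have hm : PrimrecPred fun q : List α × List α × α => q.2.2 ∈ q.2.1 := by
    have := (PrimrecRel.exists_mem_list (R := fun x y : α => x = y) Primrec.eq).comp
      (f := fun q : List α × List α × α => q.2.1) (g := fun q => q.2.2)
      (Primrec.fst.comp Primrec.snd) (Primrec.snd.comp Primrec.snd)
    exact this.of_eq fun q => by simp
  refine Primrec.list_foldl Primrec.id (Primrec.const []) (h := fun (_ : List α) q =>
    if q.2 ∈ q.1 then q.1 else q.1 ++ [q.2]) ?_
  exact Primrec.ite hm (Primrec.fst.comp Primrec.snd)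
    (Primrec.list_concat.comp (Primrec.fst.comp Primrec.snd) (Primrec.snd.comp Primrec.snd))

end Collect

/-! ### Describing an element by its position in an enumeration relative to the oracle. -/

section Search

theorem recursiveIn₂_search (a : ℕ → ℕ) {G : List ℕ → List Bool × List Bool → Option (List Bool)}
    (hG : Primrec₂ G) :
    RecursiveIn₂ {(a : ℕ →. ℕ)} fun π τ : List Bool =>
      Nat.rfindOpt fun j => G (initSeg a j) (π, τ) := by
  have h := recursiveIn_search a (fun l _ m => (decode (α := List Bool × List Bool) m).bind fun p =>
    (G l p).map encode) ?_
  · refine h.of_eq fun m => ?_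
    refine Part.ext fun y => Iff.trans ?_ Part.mem_bind_iff.symm
    cases hm : decode (α := List Bool × List Bool) m with
    | none => simp [mem_rfindOpt_iff]
    | some p =>
      simp only [mem_rfindOpt_iff, Option.bind_some, Option.map_eq_some_iff,
        Option.map_eq_none_iff, Part.coe_some, Part.mem_some_iff, exists_eq_left, Part.mem_map_iff]
      constructor
      · rintro ⟨j, ⟨σ, h1, h2⟩, h3⟩
        exact ⟨σ, ⟨j, h1, h3⟩, h2⟩
      · rintro ⟨σ, ⟨j, h1, h3⟩, h2⟩
        exact ⟨j, ⟨σ, h1, h2⟩, h3⟩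
  · refine (Primrec.option_bind (Primrec.decode.comp (Primrec.snd.comp Primrec.snd))
      (Primrec.option_map (hG.comp (Primrec.fst.comp Primrec.fst) Primrec.snd)
        (Primrec.encode.comp Primrec.snd).to₂).to₂).to_comp

/-- All the elements that show up in `W` while reading the initial segments of `l`, without
repetitions. -/
def enumUpTo (W : List ℕ → ℕ → List Bool → List (List Bool)) (l : List ℕ) (h : ℕ)
    (τ : List Bool) : List (List Bool) :=
  collect ((List.range l.length).flatMap fun i => W (l.take i) h τ)

theorem primrec_enumUpTo {W : List ℕ → ℕ → List Bool → List (List Bool)}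
    (hW : Primrec fun q : List ℕ × ℕ × List Bool => W q.1 q.2.1 q.2.2) :
    Primrec fun q : List ℕ × ℕ × List Bool => enumUpTo W q.1 q.2.1 q.2.2 := by
  refine primrec_collect.comp (Primrec.list_flatMap
    (Primrec.list_range.comp (Primrec.list_length.comp Primrec.fst)) ?_)
  exact hW.comp ((Primrec.list_take.comp Primrec.snd (Primrec.fst.comp Primrec.fst)).pair
    (Primrec.snd.comp Primrec.fst))

theorem take_initSeg (a : ℕ → ℕ) {i j : ℕ} (h : i ≤ j) :
    (initSeg a j).take i = initSeg a i := by
  simp [initSeg, ← List.map_take, List.take_range, h]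

@[simp] theorem length_initSeg (a : ℕ → ℕ) (j : ℕ) : (initSeg a j).length = j := by
  simp [initSeg]

theorem enumUpTo_initSeg (W : List ℕ → ℕ → List Bool → List (List Bool)) (a : ℕ → ℕ) (j h : ℕ)
    (τ : List Bool) : enumUpTo W (initSeg a j) h τ =
      collect ((List.range j).flatMap fun i => W (initSeg a i) h τ) := by
  rw [enumUpTo, length_initSeg]
  congr 1
  refine List.flatMap_congr fun i hi => ?_
  rw [take_initSeg a (List.mem_range.1 hi).le]

theorem mem_enumUpTo_initSeg {W : List ℕ → ℕ → List Bool → List (List Bool)} {a : ℕ → ℕ} {j h : ℕ}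
    {τ σ : List Bool} : σ ∈ enumUpTo W (initSeg a j) h τ ↔
      ∃ i < j, σ ∈ W (initSeg a i) h τ := by
  simp [enumUpTo_initSeg, mem_collect]

theorem enumUpTo_prefix (W : List ℕ → ℕ → List Bool → List (List Bool)) (a : ℕ → ℕ) {i j : ℕ}
    (hij : i ≤ j) (h : ℕ) (τ : List Bool) :
    enumUpTo W (initSeg a i) h τ <+: enumUpTo W (initSeg a j) h τ := by
  rw [enumUpTo_initSeg, enumUpTo_initSeg]
  refine collect_prefix ?_
  obtain ⟨d, rfl⟩ := Nat.exists_eq_add_of_le hij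
  rw [List.range_add, List.flatMap_append]
  exact List.prefix_append _ _

/-- The header of a program: the number `v`, in a self-delimiting way. -/
def header (v : ℕ) : List Bool := List.replicate v.size true ++ false :: v.bits

theorem length_header (v : ℕ) : (header v).length = 2 * v.size + 1 := by
  simp [header, Nat.size_eq_bits_len]
  ring

/-- The value of the header of a program. -/
def headerValue (π : List Bool) : ℕ :=
  natOfBits ((π.drop (π.idxOf false + 1)).take (π.idxOf false))

theorem idxOf_header_append (v : ℕ) (π : List Bool) : (header v ++ π).idxOf false = v.size := by
  rw [header, List.append_assoc, List.idxOf_append_of_notMem (by simp [List.mem_replicate])]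
  simp

theorem headerValue_header_append (v : ℕ) (π : List Bool) : headerValue (header v ++ π) = v := by
  have h : (header v ++ π).drop (v.size + 1) = v.bits ++ π := by
    rw [header, List.append_assoc, List.drop_append]
    simp
  rw [headerValue, idxOf_header_append, h, List.take_append_of_le_length
    (by rw [Nat.size_eq_bits_len]), List.take_of_length_le (by rw [Nat.size_eq_bits_len]),
    natOfBits_bits]

/-- One step of the search of the machine that looks up elements in the enumerations by `W`. -/
def lookupStep (W : List ℕ → ℕ → List Bool → List (List Bool)) (l : List ℕ)
    (p : List Bool × List Bool) : Option (List Bool) :=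
  -- The header codes `(h, L)` and occupies `2 * idxOf + 1` digits; the payload, an index into the
  -- enumeration, must have exactly `L` digits.
  if p.1.length = 2 * p.1.idxOf false + 1 + (headerValue p.1).unpair.2 then
    (enumUpTo W l (headerValue p.1).unpair.1 p.2)[natOfBits (p.1.drop (2 * p.1.idxOf false + 1))]?
  else none

theorem primrec_lookupStep {W : List ℕ → ℕ → List Bool → List (List Bool)}
    (hW : Primrec fun q : List ℕ × ℕ × List Bool => W q.1 q.2.1 q.2.2) :
    Primrec₂ (lookupStep W) := by
  have hπ : Primrec fun q : List ℕ × (List Bool × List Bool) => q.2.1 :=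
    Primrec.fst.comp Primrec.snd
  have hi : Primrec fun q : List ℕ × (List Bool × List Bool) => q.2.1.idxOf false :=
    Primrec.list_idxOf.comp (Primrec.const false) hπ
  have hi2 : Primrec fun q : List ℕ × (List Bool × List Bool) => 2 * q.2.1.idxOf false + 1 :=
    Primrec.nat_double_succ.comp hi
  have hv : Primrec fun q : List ℕ × (List Bool × List Bool) => (headerValue q.2.1).unpair :=
    Primrec.unpair.comp (primrec_natOfBits.comp (Primrec.list_take.comp hi
      (Primrec.list_drop.comp (Primrec.succ.comp hi) hπ)))
  refine Primrec.ite (Primrec.eq.comp (Primrec.list_length.comp hπ)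
    (Primrec.nat_add.comp hi2 (Primrec.snd.comp hv))) ?_ (Primrec.const none)
  refine Primrec.list_getElem?.comp ?_ (primrec_natOfBits.comp (Primrec.list_drop.comp hi2 hπ))
  exact (primrec_enumUpTo hW).comp (Primrec.fst.pair ((Primrec.fst.comp hv).pair
    (Primrec.snd.comp Primrec.snd)))

/-- The header delimits itself and announces the length of the payload. A halting extension of a
halting program has the same header, hence the same length. -/
theorem isPrefixFreeMachine_lookup (A : Set (List Bool))
    {W : List ℕ → ℕ → List Bool → List (List Bool)}
    (hW : Primrec fun q : List ℕ × ℕ × List Bool => W q.1 q.2.1 q.2.2) :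
    IsPrefixFreeMachine A fun π τ =>
      Nat.rfindOpt fun j => lookupStep W (initSeg (oracleChar A) j) (π, τ) where
  recursive := recursiveIn₂_search _ (primrec_lookupStep hW)
  prefixFree := by
    have key : ∀ π τ, (Nat.rfindOpt fun j =>
        lookupStep W (initSeg (oracleChar A) j) (π, τ)).Dom →
        π.length = 2 * π.idxOf false + 1 + (headerValue π).unpair.2 := by
      intro π τ h
      obtain ⟨y, hy⟩ := Part.dom_iff_mem.1 h
      obtain ⟨j, hj, -⟩ := (mem_rfindOpt_iff _ _).1 hy
      by_contra hne
      simp [lookupStep, hne] at hj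
    rintro τ π₁ _ h₁ h₂ ⟨ρ, rfl⟩
    have e₁ := key _ _ h₁
    have e₂ := key _ _ h₂
    have hi : (π₁ ++ ρ).idxOf false = π₁.idxOf false :=
      List.idxOf_append_of_mem (List.idxOf_lt_length_iff.1 (by omega))
    have hv : headerValue (π₁ ++ ρ) = headerValue π₁ := by
      rw [headerValue, headerValue, hi, List.drop_append_of_le_length (by omega),
        List.take_append_of_le_length (by rw [List.length_drop]; omega)]
    rw [hi, hv, List.length_append] at e₂
    have : ρ.length = 0 := by omega
    simp [List.length_eq_zero_iff.1 this]

/-- An element of a set with at most `2 ^ L` elements that can be enumerated with oracle `A`,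
uniformly in a number `h` and in `τ`, has complexity at most about `L` given `τ`. -/
theorem IsUniversalMachine.K_le_of_enumerable {A : Set (List Bool)}
    {U : List Bool → List Bool →. List Bool} (hU : IsUniversalMachine A U)
    {W : List ℕ → ℕ → List Bool → List (List Bool)}
    (hW : Primrec fun q : List ℕ × ℕ × List Bool => W q.1 q.2.1 q.2.2) :
    ∃ c : ℕ, ∀ h τ L t σ, σ ∈ W (initSeg (oracleChar A) t) h τ →
      (∀ F : Finset (List Bool),
        (∀ σ' ∈ F, ∃ t, σ' ∈ W (initSeg (oracleChar A) t) h τ) → F.card ≤ 2 ^ L) →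
      K U σ τ ≤ L + 2 * (Nat.pair h L).size + c := by
  obtain ⟨πM, hM⟩ := hU.simulates _ (isPrefixFreeMachine_lookup A hW)
  refine ⟨πM.length + 1, fun h τ L t σ hσ hF => ?_⟩
  have hmem : σ ∈ enumUpTo W (initSeg (oracleChar A) (t + 1)) h τ :=
    mem_enumUpTo_initSeg.2 ⟨t, by omega, hσ⟩
  obtain ⟨i, hi, rfl⟩ := List.getElem_of_mem hmem
  have hiL : i < 2 ^ L := by
    refine lt_of_lt_of_le hi ?_
    have hnd : (enumUpTo W (initSeg (oracleChar A) (t + 1)) h τ).Nodup := nodup_collect _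
    rw [← List.toFinset_card_of_nodup hnd]
    refine hF _ fun σ' h' => ?_
    obtain ⟨t', -, h''⟩ := mem_enumUpTo_initSeg.1 (List.mem_toFinset.1 h')
    exact ⟨t', h''⟩
  obtain ⟨b, rfl, hb⟩ := exists_natOfBits_eq hiL
  have hlook : ∀ j, lookupStep W (initSeg (oracleChar A) j)
      (header (Nat.pair h b.length) ++ b, τ) =
        (enumUpTo W (initSeg (oracleChar A) j) h τ)[i]? := by
    intro j
    have hd : (header (Nat.pair h b.length) ++ b).drop
        (2 * (Nat.pair h b.length).size + 1) = b := by
      rw [← length_header, List.drop_left]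
    simp [lookupStep, headerValue_header_append, idxOf_header_append, length_header, hd, hb]
  refine le_trans (b := (πM ++ (header (Nat.pair h b.length) ++ b)).length)
    (Nat.sInf_le ⟨_, ?_, rfl⟩) (by simp [length_header]; omega)
  rw [hM]
  -- Positions are stable in time, so the first answer found by the search agrees with the one at
  -- stage `t + 1`.
  have hmono : ∀ {y : List Bool} {m k : ℕ}, m ≤ k →
      y ∈ lookupStep W (initSeg (oracleChar A) m) (header (Nat.pair h b.length) ++ b, τ) →
      y ∈ lookupStep W (initSeg (oracleChar A) k) (header (Nat.pair h b.length) ++ b, τ) := by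
    intro y m k hmk hy
    rw [hlook] at hy ⊢
    obtain ⟨ρ, hρ⟩ := enumUpTo_prefix W (oracleChar A) hmk h τ
    rw [← hρ]
    rw [Option.mem_def] at hy ⊢
    obtain ⟨h1, h2⟩ := List.getElem?_eq_some_iff.1 hy
    rw [List.getElem?_append_left h1, hy]
  rw [Nat.rfindOpt_mono hmono]
  refine ⟨t + 1, ?_⟩
  rw [hlook, Option.mem_def, List.getElem?_eq_getElem hi]

end Search

/-! ### Enumerating the graph of an oracle machine. -/

section Graph

/-- The graph of a machine with oracle `A` can be enumerated with oracle `A`. -/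
theorem IsPrefixFreeMachine.exists_graph {A : Set (List Bool)}
    {M : List Bool → List Bool →. List Bool} (hM : IsPrefixFreeMachine A M) :
    ∃ Γ : List ℕ → List (List Bool × List Bool × List Bool), Primrec Γ ∧
      (∀ s t, s ≤ t → ∀ x ∈ Γ (initSeg (oracleChar A) s), x ∈ Γ (initSeg (oracleChar A) t)) ∧
      ∀ π τ σ, σ ∈ M π τ ↔ ∃ t, (π, τ, σ) ∈ Γ (initSeg (oracleChar A) t) := by
  obtain ⟨g, hg, -, spec⟩ := exists_approx (oracleChar A) hM.recursive
  obtain ⟨c, hc⟩ := Nat.Partrec.Code.exists_code.1 hg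
  have hc' : ∀ l m, Nat.Partrec.Code.eval c (encode (l, m)) = g l m := by
    intro l m
    rw [hc]
    simp [Part.map_id']
  have hspec : ∀ p : List Bool × List Bool, ∀ v,
      (∃ k, v ∈ g (initSeg (oracleChar A) k) (encode p)) ↔ ∃ y ∈ M p.1 p.2, encode y = v := by
    intro p v
    rw [← spec]
    simp [Part.mem_map_iff]
  -- The length of `l` codes a triple: how many oracle values may be consulted, a bound for the
  -- computation, and an input `(π, τ)`. Letting the length grow dovetails all computations.
  let step : List ℕ → Option (List Bool × List Bool × List Bool) := fun l =>
    (decode (α := List Bool × List Bool) l.length.unpair.2.unpair.2).bind fun p =>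
      (Nat.Partrec.Code.evaln l.length.unpair.2.unpair.1 c
        (encode (l.take l.length.unpair.1, encode p))).bind fun v =>
        (decode (α := List Bool) v).map fun σ => (p.1, p.2, σ)
  have hstep : Primrec step := by
    have hu : Primrec fun l : List ℕ => l.length.unpair := Primrec.unpair.comp Primrec.list_length
    have hu2 : Primrec fun l : List ℕ => l.length.unpair.2.unpair :=
      Primrec.unpair.comp (Primrec.snd.comp hu)
    refine Primrec.option_bind (Primrec.decode.comp (Primrec.snd.comp hu2)) ?_
    refine Primrec.option_bind (Nat.Partrec.Code.primrec_evaln.comp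
      (((Primrec.fst.comp (hu2.comp Primrec.fst)).pair (Primrec.const c)).pair
        (Primrec.encode.comp ((Primrec.list_take.comp (Primrec.fst.comp (hu.comp Primrec.fst))
          Primrec.fst).pair (Primrec.encode.comp Primrec.snd))))) ?_
    refine Primrec.option_map (Primrec.decode.comp Primrec.snd) ?_
    have hp : Primrec fun q : ((List ℕ × List Bool × List Bool) × ℕ) × List Bool => q.1.1.2 :=
      Primrec.snd.comp (Primrec.fst.comp Primrec.fst)
    exact (Primrec.fst.comp hp).pair ((Primrec.snd.comp hp).pair Primrec.snd)
  have hmem : ∀ x t, x ∈ (List.range (initSeg (oracleChar A) t).length).filterMap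
      (fun i => step ((initSeg (oracleChar A) t).take i)) ↔
        ∃ i < t, step (initSeg (oracleChar A) i) = some x := by
    intro x t
    simp only [List.mem_filterMap, List.mem_range, length_initSeg]
    exact exists_congr fun i => and_congr_right fun hi => by rw [take_initSeg _ hi.le]
  refine ⟨fun l => (List.range l.length).filterMap fun i => step (l.take i),
    Primrec.listFilterMap (Primrec.list_range.comp Primrec.list_length)
      (hstep.comp (Primrec.list_take.comp Primrec.snd Primrec.fst)).to₂, ?_, fun π τ σ => ?_⟩
  · intro s t hst x hx
    obtain ⟨i, hi, h⟩ := (hmem x s).1 hx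
    exact (hmem x t).2 ⟨i, by omega, h⟩
  · simp only [hmem]
    constructor
    · intro hσ
      obtain ⟨k, hk⟩ := (hspec (π, τ) (encode σ)).2 ⟨σ, hσ, rfl⟩
      rw [← hc'] at hk
      obtain ⟨s, hs⟩ := Nat.Partrec.Code.evaln_complete.1 hk
      refine ⟨Nat.pair k (Nat.pair s (encode (π, τ))) + 1,
        Nat.pair k (Nat.pair s (encode (π, τ))), by omega, ?_⟩
      have ht := take_initSeg (oracleChar A) (Nat.left_le_pair k (Nat.pair s (encode (π, τ))))
      have hs' : Nat.Partrec.Code.evaln s c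
          (encode (initSeg (oracleChar A) k, encode (π, τ))) = some (encode σ) := hs
      simp only [step, length_initSeg, Nat.unpair_pair, ht, encodek, Option.bind_some, hs',
        Option.map_some]
    · rintro ⟨-, i, -, h⟩
      simp only [step, Option.bind_eq_some_iff, Option.map_eq_some_iff, Prod.mk.injEq] at h
      obtain ⟨p, -, v, hv, σ', h', rfl, rfl, rfl⟩ := h
      have hv' := Nat.Partrec.Code.evaln_sound hv
      rw [hc', length_initSeg, take_initSeg _ (Nat.unpair_left_le _)] at hv'
      obtain ⟨y, hy, rfl⟩ := (hspec p v).1 ⟨_, hv'⟩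
      rw [encodek] at h'
      exact Option.some_injective _ h' ▸ hy

end Graph

/-! ### Counting programs, and the cost of computable maps. -/

section Counting

/-- Read `R x π` as saying that `π` describes `x`: distinct objects need distinct descriptions, and
there are `2 ^ m` strings of length `m`. -/
theorem card_le_two_pow_of_strings {α : Type*} {F : Finset α} {m : ℕ}
    (R : α → List Bool → Prop) (h : ∀ x ∈ F, ∃ π : List Bool, π.length = m ∧ R x π)
    (hR : ∀ x ∈ F, ∀ x' ∈ F, ∀ π, R x π → R x' π → x = x') : F.card ≤ 2 ^ m := by
  choose! p hp hp' using h
  rw [← Finset.card_range (2 ^ m)]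
  refine Finset.card_le_card_of_injOn (fun x => natOfBits (p x)) (fun x hx => ?_) ?_
  · simpa [hp x hx] using natOfBits_lt (p x)
  · intro x hx x' hx' e
    have : p x = p x' := natOfBits_injOn ((hp x hx).trans (hp x' hx').symm) e
    exact hR x hx x' hx' (p x) (hp' x hx) (this ▸ hp' x' hx')

/-- `Nat.size` plays the role of the logarithm; this controls the headers when several parameters
are packed into one number. -/
theorem size_pair_le (m k : ℕ) : (Nat.pair m k).size ≤ 2 * (m.size + k.size) := by
  rw [Nat.size_le]
  have h1 : m < 2 ^ m.size := Nat.lt_size_self m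
  have h2 : k < 2 ^ k.size := Nat.lt_size_self k
  have h3 : (2 : ℕ) ^ m.size ≤ 2 ^ (m.size + k.size) := Nat.pow_le_pow_right (by norm_num) (by omega)
  have h4 : (2 : ℕ) ^ k.size ≤ 2 ^ (m.size + k.size) := Nat.pow_le_pow_right (by norm_num) (by omega)
  calc Nat.pair m k < (max m k + 1) ^ 2 := Nat.pair_lt_max_add_one_sq m k
    _ ≤ (2 ^ (m.size + k.size)) ^ 2 := Nat.pow_le_pow_left (by omega) 2
    _ = _ := by rw [← pow_mul, mul_comm]

theorem size_succ_le (m : ℕ) : (m + 1).size ≤ m.size + 1 := by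
  rw [Nat.size_le, pow_succ]
  have := Nat.lt_size_self m
  have := Nat.one_le_two_pow (n := m.size)
  omega

theorem primrec_two_pow : Primrec fun m : ℕ => 2 ^ m :=
  (Primrec₂.unpaired'.1 Nat.Primrec.pow).comp (Primrec.const 2) Primrec.id

/-- The machine outputs on the programs of length `m` (without side information), in the part `Γ`
of the graph, that `f i` maps to `τ`; here `v` codes the pair `(i, m)`. -/
def outputsOver (Γ : List (List Bool × List Bool × List Bool)) (f : ℕ → List Bool → List Bool)
    (v : ℕ) (τ : List Bool) : List (List Bool) :=
  Γ.filterMap fun x =>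
    if (x.2.1 = [] ∧ x.1.length = v.unpair.2) ∧ f v.unpair.1 x.2.2 = τ then some x.2.2 else none

theorem mem_outputsOver {Γ : List (List Bool × List Bool × List Bool)}
    {f : ℕ → List Bool → List Bool} {i m : ℕ} {τ σ : List Bool} :
    σ ∈ outputsOver Γ f (Nat.pair i m) τ ↔
      (∃ π : List Bool, π.length = m ∧ (π, [], σ) ∈ Γ) ∧ f i σ = τ := by
  simp only [outputsOver, List.mem_filterMap, Option.ite_none_right_eq_some, Nat.unpair_pair,
    Option.some.injEq, Prod.exists]
  constructor
  · rintro ⟨π, _, σ, h, ⟨⟨rfl, hπ⟩, h2⟩, rfl⟩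
    exact ⟨⟨π, hπ, h⟩, h2⟩
  · rintro ⟨⟨π, hπ, h⟩, h2⟩
    exact ⟨π, [], σ, h, ⟨⟨rfl, hπ⟩, h2⟩, rfl⟩

theorem primrec_outputsOver {α : Type*} [Primcodable α]
    {Γ : List ℕ → List (List Bool × List Bool × List Bool)} {f : ℕ → List Bool → List Bool}
    (hΓ : Primrec Γ) (hf : Primrec₂ f) {l : α → List ℕ} {v : α → ℕ} {τ : α → List Bool}
    (hl : Primrec l) (hv : Primrec v) (hτ : Primrec τ) :
    Primrec fun z => outputsOver (Γ (l z)) f (v z) (τ z) := by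
  refine Primrec.listFilterMap (hΓ.comp hl) ?_
  have hx : Primrec fun z : α × (List Bool × List Bool × List Bool) => z.2 := Primrec.snd
  have hv' : Primrec fun z : α × (List Bool × List Bool × List Bool) => (v z.1).unpair :=
    Primrec.unpair.comp (hv.comp Primrec.fst)
  have hσ := Primrec.snd.comp (Primrec.snd.comp hx)
  exact Primrec.ite (PrimrecPred.and (PrimrecPred.and
    (Primrec.eq.comp (Primrec.fst.comp (Primrec.snd.comp hx)) (Primrec.const []))
    (Primrec.eq.comp (Primrec.list_length.comp (Primrec.fst.comp hx)) (Primrec.snd.comp hv')))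
    (Primrec.eq.comp (hf.comp (Primrec.fst.comp hv') hσ) (hτ.comp Primrec.fst)))
    (Primrec.option_some.comp hσ) (Primrec.const none)

/-- Complexity does not increase much under computable functions with an advice `h`. -/
theorem IsUniversalMachine.K_map_le {A : Set (List Bool)}
    {U : List Bool → List Bool →. List Bool} (hU : IsUniversalMachine A U)
    {g : ℕ → List Bool → List Bool} (hg : Primrec₂ g) :
    ∃ c : ℕ, ∀ h σ, K U (g h σ) [] ≤ K U σ [] + 12 * (h.size + (K U σ []).size) + c := by
  obtain ⟨Γ, hΓ, -, spec⟩ := hU.toIsPrefixFreeMachine.exists_graph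
  -- The fiber condition is made void by a constant map, so all outputs of programs of length `K(σ)`
  -- are listed and then mapped by `g h`.
  have hW : Primrec fun q : List ℕ × ℕ × List Bool =>
      (outputsOver (Γ q.1) (fun _ _ => []) q.2.1 []).map (g q.2.1.unpair.1) := by
    refine Primrec.list_map (primrec_outputsOver hΓ (Primrec₂.const []) Primrec.fst
      (Primrec.fst.comp Primrec.snd) (Primrec.const [])) ?_
    exact hg.comp (Primrec.fst.comp (Primrec.unpair.comp
      (Primrec.fst.comp (Primrec.snd.comp Primrec.fst)))) Primrec.snd
  obtain ⟨c, hc⟩ := hU.K_le_of_enumerable (W := fun l v _ =>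
    (outputsOver (Γ l) (fun _ _ => []) v []).map (g v.unpair.1)) hW
  refine ⟨c, fun h σ => ?_⟩
  obtain ⟨π, hπ, hl⟩ := hU.exists_length_eq_K σ []
  obtain ⟨t, ht⟩ := (spec _ _ _).1 hπ
  refine (hc (Nat.pair h (K U σ [])) [] (K U σ []) t _ ?_ ?_).trans ?_
  · rw [Nat.unpair_pair]
    exact List.mem_map.2 ⟨σ, mem_outputsOver.2 ⟨⟨π, hl, ht⟩, rfl⟩, rfl⟩
  · intro F hF
    refine card_le_two_pow_of_strings (fun σ' π => ∃ ρ ∈ U π [], g h ρ = σ') (fun σ' hσ' => ?_) ?_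
    · obtain ⟨t, ht⟩ := hF σ' hσ'
      rw [Nat.unpair_pair] at ht
      obtain ⟨ρ, hρ, rfl⟩ := List.mem_map.1 ht
      obtain ⟨⟨π, hπ, hm⟩, -⟩ := mem_outputsOver.1 hρ
      exact ⟨π, hπ, ρ, (spec _ _ _).2 ⟨t, hm⟩, rfl⟩
    · rintro _ - _ - π ⟨ρ, hρ, rfl⟩ ⟨ρ', hρ', rfl⟩
      rw [Part.mem_unique hρ hρ']
  · have h1 := size_pair_le (Nat.pair h (K U σ [])) (K U σ [])
    have h2 := size_pair_le h (K U σ [])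
    omega

end Counting

/-! ### The hard half of the chain rule. -/

section ChainRule

variable {A : Set (List Bool)} {U : List Bool → List Bool →. List Bool}

/-- The set of the strings of complexity at most `m` witnessed by programs of length `m` that `f i`
maps to `τ`. -/
def fiberOutputs (U : List Bool → List Bool →. List Bool) (f : ℕ → List Bool → List Bool)
    (i m : ℕ) (τ : List Bool) : Set (List Bool) :=
  {σ | (∃ π : List Bool, π.length = m ∧ σ ∈ U π []) ∧ f i σ = τ}

theorem card_le_of_subset_fiberOutputs {f : ℕ → List Bool → List Bool} {i m : ℕ} {τ : List Bool}
    {F : Finset (List Bool)} (h : ∀ σ ∈ F, σ ∈ fiberOutputs U f i m τ) : F.card ≤ 2 ^ m :=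
  card_le_two_pow_of_strings (fun σ π => σ ∈ U π []) (fun σ hσ => (h σ hσ).1)
    fun _ _ _ _ _ h1 h2 => Part.mem_unique h1 h2

theorem finite_fiberOutputs (f : ℕ → List Bool → List Bool) (i m : ℕ) (τ : List Bool) :
    (fiberOutputs U f i m τ).Finite := by
  by_contra h
  obtain ⟨F, hF, hc⟩ := Set.Infinite.exists_subset_card_eq h (2 ^ m + 1)
  have := card_le_of_subset_fiberOutputs (U := U) (f := f) (i := i) (m := m) (τ := τ) (F := F)
    fun σ hσ => hF hσ
  omega

/-- The values of `f i` whose fibers, in the part `Γ` of the graph, have at least `2 ^ e` elements;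
here `v` codes `((i, m), e)`. -/
def largeFiberValues (Γ : List (List Bool × List Bool × List Bool)) (f : ℕ → List Bool → List Bool)
    (v : ℕ) : List (List Bool) :=
  Γ.filterMap fun x =>
    if 2 ^ v.unpair.2 ≤ (collect (outputsOver Γ f v.unpair.1 (f v.unpair.1.unpair.1 x.2.2))).length
      then some (f v.unpair.1.unpair.1 x.2.2) else none

theorem mem_largeFiberValues {Γ : List (List Bool × List Bool × List Bool)}
    {f : ℕ → List Bool → List Bool} {i m e : ℕ} {τ : List Bool} :
    τ ∈ largeFiberValues Γ f (Nat.pair (Nat.pair i m) e) ↔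
      2 ^ e ≤ (collect (outputsOver Γ f (Nat.pair i m) τ)).length ∧ ∃ x ∈ Γ, f i x.2.2 = τ := by
  simp only [largeFiberValues, Nat.unpair_pair, List.mem_filterMap, Option.ite_none_right_eq_some,
    Option.some.injEq]
  constructor
  · rintro ⟨x, hx, h, rfl⟩
    exact ⟨h, x, hx, rfl⟩
  · rintro ⟨h, x, hx, rfl⟩
    exact ⟨x, hx, h, rfl⟩

theorem primrec_largeFiberValues {Γ : List ℕ → List (List Bool × List Bool × List Bool)}
    {f : ℕ → List Bool → List Bool} (hΓ : Primrec Γ) (hf : Primrec₂ f) :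
    Primrec fun q : List ℕ × ℕ × List Bool => largeFiberValues (Γ q.1) f q.2.1 := by
  refine Primrec.listFilterMap (hΓ.comp Primrec.fst) ?_
  have hl : Primrec fun z : (List ℕ × ℕ × List Bool) × (List Bool × List Bool × List Bool) =>
      z.1.1 := Primrec.fst.comp Primrec.fst
  have hv : Primrec fun z : (List ℕ × ℕ × List Bool) × (List Bool × List Bool × List Bool) =>
      z.1.2.1.unpair := Primrec.unpair.comp (Primrec.fst.comp (Primrec.snd.comp Primrec.fst))
  have hfx : Primrec fun z : (List ℕ × ℕ × List Bool) × (List Bool × List Bool × List Bool) =>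
      f z.1.2.1.unpair.1.unpair.1 z.2.2.2 := hf.comp
    (Primrec.fst.comp (Primrec.unpair.comp (Primrec.fst.comp hv)))
    (Primrec.snd.comp (Primrec.snd.comp Primrec.snd))
  have ho : Primrec fun z : (List ℕ × ℕ × List Bool) × (List Bool × List Bool × List Bool) =>
      outputsOver (Γ z.1.1) f z.1.2.1.unpair.1 (f z.1.2.1.unpair.1.unpair.1 z.2.2.2) :=
    primrec_outputsOver hΓ hf hl (Primrec.fst.comp hv) hfx
  have hp : Primrec fun z : (List ℕ × ℕ × List Bool) × (List Bool × List Bool × List Bool) =>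
      2 ^ z.1.2.1.unpair.2 := primrec_two_pow.comp (Primrec.snd.comp hv)
  have hc := Primrec.list_length.comp (primrec_collect.comp ho)
  exact Primrec.ite (Primrec.nat_le.comp hp hc) (Primrec.option_some.comp hfx) (Primrec.const none)

/-- The hard half of the chain rule, for pairs `(f i σ, σ)`. -/
theorem IsUniversalMachine.K_add_K_le (hU : IsUniversalMachine A U)
    {f : ℕ → List Bool → List Bool} (hf : Primrec₂ f) :
    ∃ c : ℕ, ∀ i σ, K U σ (f i σ) + K U (f i σ) [] ≤
      K U σ [] + 60 * (i.size + (K U σ []).size) + c := by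
  obtain ⟨Γ, hΓ, mono, spec⟩ := hU.toIsPrefixFreeMachine.exists_graph
  have hO := primrec_outputsOver hΓ hf (α := List ℕ × ℕ × List Bool) Primrec.fst
    (Primrec.fst.comp Primrec.snd) (Primrec.snd.comp Primrec.snd)
  have mem_iff : ∀ i m τ σ, σ ∈ fiberOutputs U f i m τ ↔
      ∃ t, σ ∈ outputsOver (Γ (initSeg (oracleChar A) t)) f (Nat.pair i m) τ := by
    intro i m τ σ
    simp only [mem_outputsOver]
    constructor
    · rintro ⟨⟨π, hπ, h⟩, h2⟩
      obtain ⟨t, ht⟩ := (spec _ _ _).1 h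
      exact ⟨t, ⟨π, hπ, ht⟩, h2⟩
    · rintro ⟨t, ⟨π, hπ, ht⟩, h2⟩
      exact ⟨⟨π, hπ, (spec _ _ _).2 ⟨t, ht⟩⟩, h2⟩
  obtain ⟨c₁, hc₁⟩ := hU.K_le_of_enumerable (W := fun l v τ => outputsOver (Γ l) f v τ) hO
  obtain ⟨c₂, hc₂⟩ := hU.K_le_of_enumerable (W := fun l v _ => largeFiberValues (Γ l) f v)
    (primrec_largeFiberValues hΓ hf)
  refine ⟨c₁ + c₂ + 10, fun i σ => ?_⟩
  obtain ⟨π, hπ, hl⟩ := hU.exists_length_eq_K σ []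
  set m := K U σ [] with hm
  set τ := f i σ with hτ
  have hfin := finite_fiberOutputs (U := U) f i m τ
  -- The size `N` of the fiber of `τ`, through `e = ⌊log₂ N⌋`, splits the `m` bits describing `σ`:
  -- about `e` of them locate `σ` in its fiber, and `m - e` locate `τ` among the values with large
  -- fibers.
  set N := hfin.toFinset.card with hN
  have hσ : σ ∈ fiberOutputs U f i m τ := ⟨⟨π, hl, hπ⟩, rfl⟩
  have hN0 : N ≠ 0 := Finset.card_ne_zero_of_mem (hfin.mem_toFinset.2 hσ)
  have hNm : N ≤ 2 ^ m := card_le_of_subset_fiberOutputs fun σ h => hfin.mem_toFinset.1 h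
  have hlog : 2 ^ Nat.log 2 N ≤ N := Nat.pow_log_le_self 2 hN0
  have hlog' : N < 2 ^ (Nat.log 2 N + 1) := Nat.lt_pow_succ_log_self (by norm_num) N
  set e := Nat.log 2 N with he
  have hem : e ≤ m := (Nat.pow_le_pow_iff_right (by norm_num : 1 < 2)).1 (hlog.trans hNm)
  have h₁ : K U σ τ ≤ (e + 1) + 2 * (Nat.pair (Nat.pair i m) (e + 1)).size + c₁ := by
    obtain ⟨t, ht⟩ := (mem_iff _ _ _ _).1 hσ
    refine hc₁ _ _ _ t σ ht fun F hF => ?_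
    refine le_trans (Finset.card_le_card fun σ' h => ?_) hlog'.le
    exact hfin.mem_toFinset.2 ((mem_iff _ _ _ _).2 (hF σ' h))
  have h₂ : K U τ [] ≤ (m - e) + 2 * (Nat.pair (Nat.pair (Nat.pair i m) e) (m - e)).size + c₂ := by
    -- The fiber is finite, so at some stage all of it has appeared, and `τ` is then recognized as
    -- having at least `2 ^ e` preimages.
    have hex : ∃ t, ∀ ρ ∈ fiberOutputs U f i m τ,
        ρ ∈ outputsOver (Γ (initSeg (oracleChar A) t)) f (Nat.pair i m) τ := by
      have := fun ρ => (mem_iff i m τ ρ).1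
      choose! T hT using this
      refine ⟨hfin.toFinset.sup T, fun ρ hρ => ?_⟩
      have h := hT ρ hρ
      rw [mem_outputsOver] at h ⊢
      obtain ⟨⟨π, h1, h2⟩, h3⟩ := h
      exact ⟨⟨π, h1, mono _ _ (Finset.le_sup (hfin.mem_toFinset.2 hρ)) _ h2⟩, h3⟩
    obtain ⟨t, ht⟩ := hex
    refine hc₂ _ _ _ t τ ?_ fun F hF => ?_
    · obtain ⟨⟨π', -, hπ'⟩, -⟩ := mem_outputsOver.1 (ht σ hσ)
      refine mem_largeFiberValues.2 ⟨hlog.trans ?_, _, hπ', rfl⟩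
      rw [← List.toFinset_card_of_nodup (nodup_collect _)]
      refine Finset.card_le_card fun ρ hρ => ?_
      rw [List.mem_toFinset, mem_collect]
      exact ht ρ (hfin.mem_toFinset.1 hρ)
    · have hbig : ∀ τ' ∈ F, 2 ^ e ≤ (finite_fiberOutputs (U := U) f i m τ').toFinset.card := by
        intro τ' hτ'
        obtain ⟨t, h⟩ := hF τ' hτ'
        refine (mem_largeFiberValues.1 h).1.trans ?_
        rw [← List.toFinset_card_of_nodup (nodup_collect _)]
        refine Finset.card_le_card fun ρ hρ => ?_
        rw [List.mem_toFinset, mem_collect] at hρ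
        exact (Set.Finite.mem_toFinset _).2 ((mem_iff _ _ _ _).2 ⟨t, hρ⟩)
      have hdisj : (F : Set (List Bool)).PairwiseDisjoint
          fun τ' => (finite_fiberOutputs (U := U) f i m τ').toFinset := by
        intro τ₁ _ τ₂ _ hne
        refine Finset.disjoint_left.2 fun ρ h1 h2 => hne ?_
        rw [Set.Finite.mem_toFinset] at h1 h2
        exact h1.2.symm.trans h2.2
      -- Fibers over different values are disjoint and consist of outputs of programs of length `m`,
      -- so at most `2 ^ (m - e)` values have fibers of size at least `2 ^ e`.
      have hsum : F.card * 2 ^ e ≤ 2 ^ m := by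
        calc F.card * 2 ^ e ≤ ∑ τ' ∈ F, (finite_fiberOutputs (U := U) f i m τ').toFinset.card := by
              simpa using Finset.card_nsmul_le_sum F _ _ hbig
          _ = (F.biUnion fun τ' => (finite_fiberOutputs (U := U) f i m τ').toFinset).card :=
              (Finset.card_biUnion hdisj).symm
          _ ≤ 2 ^ m := by
              refine card_le_two_pow_of_strings (fun σ π => σ ∈ U π []) (fun ρ hρ => ?_)
                fun _ _ _ _ _ h1 h2 => Part.mem_unique h1 h2
              obtain ⟨τ', -, h⟩ := Finset.mem_biUnion.1 hρ
              exact ((Set.Finite.mem_toFinset _).1 h).1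
      refine Nat.le_of_mul_le_mul_right (hsum.trans_eq ?_) (Nat.two_pow_pos e)
      rw [← pow_add, Nat.sub_add_cancel hem]
  have p1 := size_pair_le (Nat.pair i m) (e + 1)
  have p2 := size_pair_le i m
  have p3 := size_pair_le (Nat.pair (Nat.pair i m) e) (m - e)
  have p4 := size_pair_le (Nat.pair i m) e
  have q1 := size_succ_le e
  have q2 : e.size ≤ m.size := Nat.size_le_size hem
  have q3 : (m - e).size ≤ m.size := Nat.size_le_size (by omega)
  omega

end ChainRule

/-! ### Concatenated programs and their unique decoding. -/

section Chains

variable {A : Set (List Bool)} {U : List Bool → List Bool →. List Bool}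

/-- `IsChain U σ₀ k z σ`: the string `z` is the concatenation of `k` programs, of which the first
leads from `σ₀` to the next string, and so on, up to `σ`. -/
def IsChain (U : List Bool → List Bool →. List Bool) (σ₀ : List Bool) :
    ℕ → List Bool → List Bool → Prop
  | 0, z, σ => z = [] ∧ σ = σ₀
  | k + 1, z, σ => ∃ z' ρ π, IsChain U σ₀ k z' ρ ∧ σ ∈ U π ρ ∧ z = z' ++ π

/-- By induction the parts before the last program coincide and end at the same string. The last
programs then run with the same side information and are comparable, hence equal by prefix-freeness.
A common extension `w` is used because the initial parts are not known in advance to have equal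
length. -/
theorem IsChain.unique_of_prefix
    (hU : ∀ τ π₁ π₂ : List Bool, (U π₁ τ).Dom → (U π₂ τ).Dom → π₁ <+: π₂ → π₁ = π₂)
    {σ₀ : List Bool} {k : ℕ} {z₁ z₂ w σ₁ σ₂ : List Bool} (h₁ : IsChain U σ₀ k z₁ σ₁)
    (h₂ : IsChain U σ₀ k z₂ σ₂) (p₁ : z₁ <+: w) (p₂ : z₂ <+: w) : z₁ = z₂ ∧ σ₁ = σ₂ := by
  induction k generalizing z₁ z₂ σ₁ σ₂ with
  | zero =>
    obtain ⟨rfl, rfl⟩ := h₁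
    obtain ⟨rfl, rfl⟩ := h₂
    exact ⟨rfl, rfl⟩
  | succ k ih =>
    obtain ⟨y₁, ρ₁, π₁, c₁, m₁, rfl⟩ := h₁
    obtain ⟨y₂, ρ₂, π₂, c₂, m₂, rfl⟩ := h₂
    obtain ⟨rfl, rfl⟩ := ih c₁ c₂ ((List.prefix_append _ _).trans p₁)
      ((List.prefix_append _ _).trans p₂)
    have d₁ : (U π₁ ρ₁).Dom := Part.dom_iff_mem.2 ⟨_, m₁⟩
    have d₂ : (U π₂ ρ₁).Dom := Part.dom_iff_mem.2 ⟨_, m₂⟩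
    have : π₁ = π₂ := by
      rcases List.prefix_or_prefix_of_prefix p₁ p₂ with h | h
      · exact hU ρ₁ _ _ d₁ d₂ ((List.prefix_append_right_inj _).1 h)
      · exact (hU ρ₁ _ _ d₂ d₁ ((List.prefix_append_right_inj _).1 h)).symm
    subst this
    exact ⟨rfl, Part.mem_unique m₁ m₂⟩

theorem IsChain.unique (hU : IsPrefixFreeMachine A U)
    {σ₀ : List Bool} {k : ℕ} {z σ₁ σ₂ : List Bool} (h₁ : IsChain U σ₀ k z σ₁)
    (h₂ : IsChain U σ₀ k z σ₂) : σ₁ = σ₂ :=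
  (h₁.unique_of_prefix hU.prefixFree h₂ (List.prefix_refl z) (List.prefix_refl z)).2

/-- The chains of length `k` in the part `Γ` of the graph of a machine. -/
def chainList (σ₀ : List Bool) (Γ : List (List Bool × List Bool × List Bool)) (k : ℕ) :
    List (List Bool × List Bool) :=
  Nat.rec [([], σ₀)] (fun _ C => C.flatMap fun p => Γ.filterMap fun x =>
    if x.2.1 = p.2 then some (p.1 ++ x.1, x.2.2) else none) k

theorem mem_chainList_zero {σ₀ z σ : List Bool} {Γ : List (List Bool × List Bool × List Bool)} :
    (z, σ) ∈ chainList σ₀ Γ 0 ↔ z = [] ∧ σ = σ₀ := by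
  simp [chainList]

theorem mem_chainList_succ {σ₀ z σ : List Bool} {Γ : List (List Bool × List Bool × List Bool)}
    {k : ℕ} : (z, σ) ∈ chainList σ₀ Γ (k + 1) ↔
      ∃ z' ρ π, (z', ρ) ∈ chainList σ₀ Γ k ∧ (π, ρ, σ) ∈ Γ ∧ z = z' ++ π := by
  have e : chainList σ₀ Γ (k + 1) = (chainList σ₀ Γ k).flatMap fun p => Γ.filterMap fun x =>
    if x.2.1 = p.2 then some (p.1 ++ x.1, x.2.2) else none := rfl
  simp only [e, List.mem_flatMap, List.mem_filterMap, Option.ite_none_right_eq_some,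
    Option.some.injEq, Prod.exists, Prod.mk.injEq]
  constructor
  · rintro ⟨z', ρ, h, π, _, σ, hx, rfl, rfl, rfl⟩
    exact ⟨z', _, π, h, hx, rfl⟩
  · rintro ⟨z', ρ, π, h, hx, rfl⟩
    exact ⟨z', ρ, h, π, ρ, σ, hx, rfl, rfl, rfl⟩

theorem primrec_chainList (σ₀ : List Bool) {α : Type*} [Primcodable α]
    {Γ : List ℕ → List (List Bool × List Bool × List Bool)} (hΓ : Primrec Γ)
    {l : α → List ℕ} {k : α → ℕ} (hl : Primrec l) (hk : Primrec k) :
    Primrec fun z => chainList σ₀ (Γ (l z)) (k z) := by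
  refine Primrec.nat_rec' (f := k) (g := fun _ => [([], σ₀)])
    (h := fun (z : α) (q : ℕ × List (List Bool × List Bool)) => q.2.flatMap fun p =>
    (Γ (l z)).filterMap fun x => if x.2.1 = p.2 then some (p.1 ++ x.1, x.2.2) else none)
    hk (Primrec.const _) ?_
  refine Primrec.list_flatMap (Primrec.snd.comp Primrec.snd) ?_
  refine Primrec.listFilterMap (hΓ.comp (hl.comp (Primrec.fst.comp Primrec.fst))) ?_
  have hx : Primrec fun z : ((α × ℕ × List (List Bool × List Bool)) × List Bool × List Bool) ×
      List Bool × List Bool × List Bool => z.2 := Primrec.snd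
  have hp : Primrec fun z : ((α × ℕ × List (List Bool × List Bool)) × List Bool × List Bool) ×
      List Bool × List Bool × List Bool => z.1.2 := Primrec.snd.comp Primrec.fst
  exact Primrec.ite (Primrec.eq.comp (Primrec.fst.comp (Primrec.snd.comp hx)) (Primrec.snd.comp hp))
    (Primrec.option_some.comp ((Primrec.list_append.comp (Primrec.fst.comp hp)
      (Primrec.fst.comp hx)).pair (Primrec.snd.comp (Primrec.snd.comp hx)))) (Primrec.const none)

/-- A chain uses finitely many computations, all of which have appeared in the graph by some common
stage. -/
theorem isChain_iff_exists_mem_chainList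
    {Γ : List ℕ → List (List Bool × List Bool × List Bool)} {a : ℕ → ℕ}
    (mono : ∀ s t, s ≤ t → ∀ x ∈ Γ (initSeg a s), x ∈ Γ (initSeg a t))
    (spec : ∀ π τ σ, σ ∈ U π τ ↔ ∃ t, (π, τ, σ) ∈ Γ (initSeg a t))
    {σ₀ z σ : List Bool} {k : ℕ} :
    IsChain U σ₀ k z σ ↔ ∃ t, (z, σ) ∈ chainList σ₀ (Γ (initSeg a t)) k := by
  have hmono : ∀ k z σ s t, s ≤ t → (z, σ) ∈ chainList σ₀ (Γ (initSeg a s)) k →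
      (z, σ) ∈ chainList σ₀ (Γ (initSeg a t)) k := by
    intro k
    induction k with
    | zero => exact fun z σ s t _ h => mem_chainList_zero.2 (mem_chainList_zero.1 h)
    | succ k ih =>
      intro z σ s t hst h
      obtain ⟨z', ρ, π, h1, h2, h3⟩ := mem_chainList_succ.1 h
      exact mem_chainList_succ.2 ⟨z', ρ, π, ih _ _ _ _ hst h1, mono _ _ hst _ h2, h3⟩
  induction k generalizing z σ with
  | zero => simp [IsChain, mem_chainList_zero]
  | succ k ih =>
    simp only [IsChain, mem_chainList_succ, ih, spec]
    constructor
    · rintro ⟨z', ρ, π, ⟨s, hs⟩, ⟨t, ht⟩, h⟩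
      exact ⟨max s t, z', ρ, π, hmono _ _ _ _ _ (le_max_left s t) hs,
        mono _ _ (le_max_right s t) _ ht, h⟩
    · rintro ⟨t, z', ρ, π, h1, h2, h3⟩
      exact ⟨z', ρ, π, ⟨t, h1⟩, ⟨t, h2⟩, h3⟩

/-- The end point of a chain of programs is simple, given side information that leaves few
possibilities for the concatenation of the programs. -/
theorem IsUniversalMachine.K_le_of_isChain (hU : IsUniversalMachine A U) (σ₀ : List Bool)
    {near : ℕ → List Bool → List Bool → Bool}
    (hn : Primrec fun q : ℕ × List Bool × List Bool => near q.1 q.2.1 q.2.2) :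
    ∃ c : ℕ, ∀ k r z σ τ L, IsChain U σ₀ k z σ → near r τ z = true →
      (∀ F : Finset (List Bool), (∀ z' ∈ F, z'.length = z.length ∧ near r τ z' = true) →
        F.card ≤ 2 ^ L) →
      K U σ τ ≤ L + 2 * (Nat.pair (Nat.pair k (Nat.pair r z.length)) L).size + c := by
  obtain ⟨Γ, hΓ, mono, spec⟩ := hU.toIsPrefixFreeMachine.exists_graph
  -- Here `v` codes `(k, (r, m))`: the end points of chains of `k` programs of total length `m`
  -- compatible with `τ` are listed.
  let W : List ℕ → ℕ → List Bool → List (List Bool) := fun l v τ =>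
    (chainList σ₀ (Γ l) v.unpair.1).filterMap fun p =>
      if p.1.length = v.unpair.2.unpair.2 ∧ near v.unpair.2.unpair.1 τ p.1 = true then some p.2
      else none
  have hW : Primrec fun q : List ℕ × ℕ × List Bool => W q.1 q.2.1 q.2.2 := by
    have hv : Primrec fun q : List ℕ × ℕ × List Bool => q.2.1.unpair :=
      Primrec.unpair.comp (Primrec.fst.comp Primrec.snd)
    refine Primrec.listFilterMap (primrec_chainList σ₀ hΓ Primrec.fst (Primrec.fst.comp hv)) ?_
    have hv' : Primrec fun z : (List ℕ × ℕ × List Bool) × List Bool × List Bool =>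
        z.1.2.1.unpair.2.unpair := Primrec.unpair.comp (Primrec.snd.comp (hv.comp Primrec.fst))
    have hz : Primrec fun z : (List ℕ × ℕ × List Bool) × List Bool × List Bool => z.2.1 :=
      Primrec.fst.comp Primrec.snd
    have hτ : Primrec fun z : (List ℕ × ℕ × List Bool) × List Bool × List Bool => z.1.2.2 :=
      Primrec.snd.comp (Primrec.snd.comp Primrec.fst)
    have hn' : Primrec fun z : (List ℕ × ℕ × List Bool) × List Bool × List Bool =>
        near z.1.2.1.unpair.2.unpair.1 z.1.2.2 z.2.1 :=
      Primrec.comp hn (g := fun z : (List ℕ × ℕ × List Bool) × List Bool × List Bool =>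
        (z.1.2.1.unpair.2.unpair.1, z.1.2.2, z.2.1)) ((Primrec.fst.comp hv').pair (hτ.pair hz))
    exact Primrec.ite (PrimrecPred.and (Primrec.eq.comp (Primrec.list_length.comp hz)
      (Primrec.snd.comp hv')) (Primrec.eq.comp hn' (Primrec.const true)))
      (Primrec.option_some.comp (Primrec.snd.comp Primrec.snd)) (Primrec.const none)
  have hmem : ∀ k r m τ σ, (∃ t, σ ∈ W (initSeg (oracleChar A) t)
      (Nat.pair k (Nat.pair r m)) τ) ↔
        ∃ z, IsChain U σ₀ k z σ ∧ z.length = m ∧ near r τ z = true := by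
    intro k r m τ σ
    simp only [W, Nat.unpair_pair, List.mem_filterMap, Option.ite_none_right_eq_some,
      Option.some.injEq, Prod.exists, isChain_iff_exists_mem_chainList mono spec]
    constructor
    · rintro ⟨t, z, _, h, h1, rfl⟩
      exact ⟨z, ⟨t, h⟩, h1⟩
    · rintro ⟨z, ⟨t, h⟩, h1⟩
      exact ⟨t, z, _, h, h1, rfl⟩
  obtain ⟨c, hc⟩ := hU.K_le_of_enumerable hW
  refine ⟨c, fun k r z σ τ L hz hr hF => ?_⟩
  obtain ⟨t, ht⟩ := (hmem k r z.length τ σ).2 ⟨z, hz, rfl, hr⟩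
  refine hc _ τ L t σ ht fun F hF' => ?_
  have hch : ∀ σ' ∈ F, ∃ z', IsChain U σ₀ k z' σ' ∧ z'.length = z.length ∧ near r τ z' = true :=
    fun σ' h => (hmem _ _ _ _ _).1 (hF' σ' h)
  choose! p hp hp' using hch
  classical
  -- A concatenation determines its end point, so there are no more end points than candidate
  -- concatenations.
  rw [← Finset.card_image_of_injOn (f := p) (s := F) ?_]
  · refine hF _ fun z' hz' => ?_
    obtain ⟨σ', h, rfl⟩ := Finset.mem_image.1 hz'
    exact hp' σ' h
  · intro σ₁ h₁ σ₂ h₂ e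
    exact (hp σ₁ h₁).unique hU.toIsPrefixFreeMachine (e ▸ hp σ₂ h₂)

end Chains

/-! ### Primitive recursive arithmetic on codes of rational vectors. -/

section RationalCodes

/-- The rational number `(2 z + 1) / 2 ^ (s + 1)`, the midpoint of a dyadic interval. -/
def gridRat (s : ℕ) (z : ℤ) : ℚ := (2 * z + 1) / 2 ^ (s + 1)

theorem encode_natCast (t : ℕ) : encode (t : ℤ) = 2 * t := rfl

theorem encode_negSucc (t : ℕ) : encode (Int.negSucc t) = 2 * t + 1 := rfl

/-- The positive part of an integer, in terms of its code. -/
def posPartOfCode (e : ℕ) : ℕ := if e % 2 = 0 then e / 2 else 0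

/-- The negative part of an integer, in terms of its code. -/
def negPartOfCode (e : ℕ) : ℕ := if e % 2 = 0 then 0 else e / 2 + 1

theorem posPartOfCode_sub_negPartOfCode (z : ℤ) :
    (posPartOfCode (encode z) : ℤ) - negPartOfCode (encode z) = z := by
  cases z with
  | ofNat t =>
    have : encode (Int.ofNat t) = 2 * t := rfl
    rw [this]
    simp [posPartOfCode, negPartOfCode]
  | negSucc t =>
    rw [encode_negSucc]
    have h1 : (2 * t + 1) % 2 ≠ 0 := by omega
    have h2 : (2 * t + 1) / 2 = t := by omega
    simp only [posPartOfCode, negPartOfCode, h1, h2, if_false]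
    omega

theorem primrec_posPartOfCode : Primrec posPartOfCode :=
  Primrec.ite (Primrec.eq.comp (Primrec.nat_mod.comp Primrec.id (Primrec.const 2))
    (Primrec.const 0)) (Primrec.nat_div.comp Primrec.id (Primrec.const 2)) (Primrec.const 0)

theorem primrec_negPartOfCode : Primrec negPartOfCode :=
  Primrec.ite (Primrec.eq.comp (Primrec.nat_mod.comp Primrec.id (Primrec.const 2))
    (Primrec.const 0)) (Primrec.const 0)
    (Primrec.succ.comp (Primrec.nat_div.comp Primrec.id (Primrec.const 2)))

theorem rat_eq_of_ratCode (q : ℚ) : q = ((posPartOfCode (ratCode q).unpair.1 : ℚ) -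
    negPartOfCode (ratCode q).unpair.1) / (ratCode q).unpair.2 := by
  have h := posPartOfCode_sub_negPartOfCode q.num
  simp only [ratCode, Nat.unpair_pair]
  have h' : ((posPartOfCode (encode q.num) : ℚ) - negPartOfCode (encode q.num)) = q.num := by
    exact_mod_cast congrArg (Int.cast : ℤ → ℚ) h
  rw [h', Rat.num_div_den]

/-- The numerator is odd and the denominator a power of two, so the fraction is already reduced and
its code is explicit. Midpoints are preferable to end points partly for this reason: no common
factor has to be cancelled. -/
theorem ratCode_gridRat (s : ℕ) (z : ℤ) :
    ratCode (gridRat s z) = Nat.pair (encode (2 * z + 1)) (2 ^ (s + 1)) := by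
  have hc : Nat.Coprime (2 * z + 1).natAbs ((2 : ℤ) ^ (s + 1)).natAbs := by
    rw [Int.natAbs_pow]
    refine Nat.Coprime.pow_right _ ?_
    rw [show (2 : ℤ).natAbs = 2 from rfl, Nat.coprime_comm, Nat.coprime_two_left,
      Int.natAbs_odd]
    exact ⟨z, rfl⟩
  have e : gridRat s z = ((2 * z + 1 : ℤ) : ℚ) / ((2 ^ (s + 1) : ℤ) : ℚ) := by
    simp [gridRat]
  have hn := Rat.num_div_eq_of_coprime (by positivity) hc
  have hd := Rat.den_div_eq_of_coprime (by positivity) hc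
  rw [ratCode, e, hn]
  congr 1
  exact_mod_cast hd

/-- From the code of `q` to the code of `gridRat s (⌊q * 2 ^ s⌋ + v - w)`. -/
def shiftCode (s w v c : ℕ) : ℕ :=
  let a := posPartOfCode c.unpair.1 * 2 ^ s + v * c.unpair.2
  let b := negPartOfCode c.unpair.1 * 2 ^ s + w * c.unpair.2
  -- The new index is `⌊(a - b) / d⌋`, with `d` the denominator. If it is `t ≥ 0`, the numerator `2
  -- t + 1` has code `4 t + 2`; if it is `-(t + 1)`, the numerator `-(2 t + 1)` has code `4 t + 1`.
  if b ≤ a then Nat.pair (4 * ((a - b) / c.unpair.2) + 2) (2 ^ (s + 1))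
  else Nat.pair (4 * ((b - a - 1) / c.unpair.2) + 1) (2 ^ (s + 1))

theorem shiftCode_ratCode (s w v : ℕ) (q : ℚ) :
    shiftCode s w v (ratCode q) = ratCode (gridRat s (⌊q * 2 ^ s⌋ + v - w)) := by
  rw [ratCode_gridRat]
  have hq := rat_eq_of_ratCode q
  have hd : 0 < (ratCode q).unpair.2 := by simp [ratCode, q.den_pos]
  simp only [shiftCode]
  generalize posPartOfCode (ratCode q).unpair.1 = m at *
  generalize negPartOfCode (ratCode q).unpair.1 = m' at *
  generalize (ratCode q).unpair.2 = d at *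
  have hd' : (0 : ℚ) < d := by exact_mod_cast hd
  have hz : ⌊q * 2 ^ s⌋ + v - w =
      (((m * 2 ^ s + v * d : ℕ) : ℤ) - ((m' * 2 ^ s + w * d : ℕ) : ℤ)) / (d : ℤ) := by
    have e : (((((m * 2 ^ s + v * d : ℕ) : ℤ) - ((m' * 2 ^ s + w * d : ℕ) : ℤ) : ℤ)) : ℚ) / (d : ℕ) =
        q * 2 ^ s + (v : ℤ) - (w : ℤ) := by
      rw [hq]
      push_cast
      field_simp
      ring
    rw [← Rat.floor_intCast_div_natCast, e, Int.floor_sub_intCast, Int.floor_add_intCast]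
  rw [hz]
  generalize m * 2 ^ s + v * d = a
  generalize m' * 2 ^ s + w * d = b
  split_ifs with h
  · obtain ⟨t, rfl⟩ := Nat.exists_eq_add_of_le h
    have : (((b + t : ℕ) : ℤ) - (b : ℤ)) / (d : ℤ) = ((t / d : ℕ) : ℤ) := by
      push_cast
      congr 1
      ring
    rw [this, show b + t - b = t by omega]
    have e : (2 * ((t / d : ℕ) : ℤ) + 1) = ((2 * (t / d) + 1 : ℕ) : ℤ) := by push_cast; ring
    rw [e, encode_natCast]
    congr 1
    ring
  · obtain ⟨t, rfl⟩ := Nat.exists_eq_add_of_lt (not_le.1 h)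
    have : ((a : ℤ) - ((a + t + 1 : ℕ) : ℤ)) / (d : ℤ) = Int.negSucc (t / d) := by
      have e : (a : ℤ) - ((a + t + 1 : ℕ) : ℤ) = Int.negSucc t := by
        rw [Int.negSucc_eq]; push_cast; ring
      rw [e, Int.negSucc_ediv _ (by exact_mod_cast hd), Int.negSucc_eq]
      rfl
    rw [this, show a + t + 1 - a - 1 = t by omega]
    have e : 2 * Int.negSucc (t / d) + 1 = Int.negSucc (2 * (t / d)) := by
      rw [Int.negSucc_eq, Int.negSucc_eq]; push_cast; ring
    rw [e, encode_negSucc]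
    congr 1
    ring

theorem primrec_shiftCode : Primrec fun q : (ℕ × ℕ) × ℕ × ℕ =>
    shiftCode q.1.1 q.1.2 q.2.1 q.2.2 := by
  have hs : Primrec fun q : (ℕ × ℕ) × ℕ × ℕ => q.1.1 := Primrec.fst.comp Primrec.fst
  have hw : Primrec fun q : (ℕ × ℕ) × ℕ × ℕ => q.1.2 := Primrec.snd.comp Primrec.fst
  have hv : Primrec fun q : (ℕ × ℕ) × ℕ × ℕ => q.2.1 := Primrec.fst.comp Primrec.snd
  have hc : Primrec fun q : (ℕ × ℕ) × ℕ × ℕ => q.2.2.unpair :=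
    Primrec.unpair.comp (Primrec.snd.comp Primrec.snd)
  have hd : Primrec fun q : (ℕ × ℕ) × ℕ × ℕ => q.2.2.unpair.2 := Primrec.snd.comp hc
  have ha : Primrec fun q : (ℕ × ℕ) × ℕ × ℕ =>
      posPartOfCode q.2.2.unpair.1 * 2 ^ q.1.1 + q.2.1 * q.2.2.unpair.2 :=
    Primrec.nat_add.comp (Primrec.nat_mul.comp (primrec_posPartOfCode.comp (Primrec.fst.comp hc))
      (primrec_two_pow.comp hs)) (Primrec.nat_mul.comp hv hd)
  have hb : Primrec fun q : (ℕ × ℕ) × ℕ × ℕ =>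
      negPartOfCode q.2.2.unpair.1 * 2 ^ q.1.1 + q.1.2 * q.2.2.unpair.2 :=
    Primrec.nat_add.comp (Primrec.nat_mul.comp (primrec_negPartOfCode.comp (Primrec.fst.comp hc))
      (primrec_two_pow.comp hs)) (Primrec.nat_mul.comp hw hd)
  have hp : Primrec fun q : (ℕ × ℕ) × ℕ × ℕ => 2 ^ (q.1.1 + 1) :=
    primrec_two_pow.comp (Primrec.succ.comp hs)
  refine Primrec.ite (Primrec.nat_le.comp hb ha) ?_ ?_
  · exact Primrec₂.natPair.comp (Primrec.nat_add.comp (Primrec.nat_mul.comp (Primrec.const 4)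
      (Primrec.nat_div.comp (Primrec.nat_sub.comp ha hb) hd)) (Primrec.const 2)) hp
  · exact Primrec₂.natPair.comp (Primrec.nat_add.comp (Primrec.nat_mul.comp (Primrec.const 4)
      (Primrec.nat_div.comp (Primrec.nat_sub.comp (Primrec.nat_sub.comp hb ha)
        (Primrec.const 1)) hd)) (Primrec.const 1)) hp

/-- The list of the codes of the coordinates of a rational vector, from the code of the vector. -/
def coordCodes (σ : List Bool) : List ℕ := (decode (α := List ℕ) (natOfBits σ)).getD []

theorem coordCodes_ratVecCode {n : ℕ} (p : Fin n → ℚ) :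
    coordCodes (ratVecCode p) = List.ofFn fun j => ratCode (p j) := by
  rw [coordCodes, ratVecCode, natOfBits_bits, encodek, Option.getD_some]

theorem primrec_coordCodes : Primrec coordCodes :=
  Primrec.option_getD.comp (Primrec.decode.comp primrec_natOfBits) (Primrec.const [])

/-- From the code of a vector `p` to the code of the vector with the coordinates
`gridRat s (⌊p j * 2 ^ s⌋ + v j - w)`; here `h` codes `(s, (w, v))`. -/
def shiftVec (h : ℕ) (σ : List Bool) : List Bool :=
  (encode ((List.range (coordCodes σ).length).map fun j =>
    shiftCode h.unpair.1 h.unpair.2.unpair.1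
      (((decode (α := List ℕ) h.unpair.2.unpair.2).getD []).getD j 0)
      ((coordCodes σ).getD j 0))).bits

theorem shiftVec_ratVecCode {n : ℕ} (s w : ℕ) (v : List ℕ) (p : Fin n → ℚ) :
    shiftVec (Nat.pair s (Nat.pair w (encode v))) (ratVecCode p) =
      ratVecCode fun j => gridRat s (⌊p j * 2 ^ s⌋ + (v.getD j 0 : ℕ) - w) := by
  simp only [shiftVec, coordCodes_ratVecCode, Nat.unpair_pair, encodek, Option.getD_some]
  rw [ratVecCode]
  congr 2
  refine List.ext_getElem (by simp) fun j h1 h2 => ?_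
  have hj : j < n := by simpa using h1
  simp only [List.getElem_map, List.getElem_range, List.getElem_ofFn]
  rw [← shiftCode_ratCode]
  congr 1
  rw [List.getD_eq_getElem _ _ (by simpa using hj), List.getElem_ofFn]

theorem primrec_shiftVec : Primrec₂ shiftVec := by
  refine primrec_bits.comp (Primrec.encode.comp (Primrec.list_map (Primrec.list_range.comp
    (Primrec.list_length.comp (primrec_coordCodes.comp Primrec.snd))) ?_))
  have hh : Primrec fun z : (ℕ × List Bool) × ℕ => z.1.1.unpair :=
    Primrec.unpair.comp (Primrec.fst.comp Primrec.fst)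
  have hh' : Primrec fun z : (ℕ × List Bool) × ℕ => z.1.1.unpair.2.unpair :=
    Primrec.unpair.comp (Primrec.snd.comp hh)
  have hv : Primrec fun z : (ℕ × List Bool) × ℕ =>
      ((decode (α := List ℕ) z.1.1.unpair.2.unpair.2).getD []).getD z.2 0 :=
    (Primrec.list_getD 0).comp (Primrec.option_getD.comp
      (Primrec.decode.comp (Primrec.snd.comp hh')) (Primrec.const [])) Primrec.snd
  have hc : Primrec fun z : (ℕ × List Bool) × ℕ => (coordCodes z.1.2).getD z.2 0 :=
    (Primrec.list_getD 0).comp (primrec_coordCodes.comp (Primrec.snd.comp Primrec.fst)) Primrec.snd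
  exact Primrec.comp primrec_shiftCode (g := fun z : (ℕ × List Bool) × ℕ =>
    ((z.1.1.unpair.1, z.1.1.unpair.2.unpair.1),
      (((decode (α := List ℕ) z.1.1.unpair.2.unpair.2).getD []).getD z.2 0,
        (coordCodes z.1.2).getD z.2 0)))
    (((Primrec.fst.comp hh).pair (Primrec.fst.comp hh')).pair (hv.pair hc))

end RationalCodes

/-! ### Compatibility of dyadic grids. -/

section Grid

/-- The fine dyadic interval of `y` lies in its coarse one, and the midpoint is interior. Thus the
coarse approximation is computable from the fine one, as the chain rule requires. -/
theorem floor_gridRat_mul {s s' : ℕ} (h : s ≤ s') (y : ℝ) :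
    ⌊gridRat s' ⌊y * 2 ^ s'⌋ * 2 ^ s⌋ = ⌊y * 2 ^ s⌋ := by
  obtain ⟨d, rfl⟩ := Nat.exists_eq_add_of_le h
  set N := ⌊y * 2 ^ s⌋ with hN
  obtain ⟨h1, h2⟩ := Int.floor_eq_iff.1 hN.symm
  set z := ⌊y * 2 ^ (s + d)⌋ with hz
  have e : y * 2 ^ (s + d) = (y * 2 ^ s) * 2 ^ d := by rw [pow_add]; ring
  have h3 : N * 2 ^ d ≤ z := by
    rw [hz, Int.le_floor, e]
    push_cast
    exact mul_le_mul_of_nonneg_right h1 (by positivity)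
  have h4 : z < (N + 1) * 2 ^ d := by
    rw [hz, Int.floor_lt, e]
    push_cast
    exact mul_lt_mul_of_pos_right h2 (by positivity)
  have h3' : (N : ℚ) * 2 ^ d ≤ z := by exact_mod_cast h3
  have h4' : (z : ℚ) + 1 ≤ (N + 1) * 2 ^ d := by exact_mod_cast h4
  have e2 : gridRat (s + d) z * 2 ^ s = (z + 1 / 2) / 2 ^ d := by
    rw [gridRat]
    field_simp
    ring
  rw [e2, Int.floor_eq_iff, le_div_iff₀ (by positivity), div_lt_iff₀ (by positivity)]
  exact ⟨by linarith, by linarith⟩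

theorem abs_gridRat_sub_le (s : ℕ) (y : ℝ) :
    |((gridRat s ⌊y * 2 ^ s⌋ : ℚ) : ℝ) - y| ≤ 1 / 2 ^ s := by
  have h1 := Int.floor_le (y * 2 ^ s)
  have h2 := Int.lt_floor_add_one (y * 2 ^ s)
  have h0 : (0 : ℝ) < 2 ^ s := by positivity
  have e : ((gridRat s ⌊y * 2 ^ s⌋ : ℚ) : ℝ) - y =
      ((⌊y * 2 ^ s⌋ : ℝ) + 1 / 2 - y * 2 ^ s) / 2 ^ s := by
    rw [gridRat]
    push_cast
    field_simp
    ring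
  rw [e, abs_div, abs_of_pos h0]
  refine div_le_div_of_nonneg_right ?_ h0.le
  rw [abs_le]
  constructor <;> linarith

end Grid

/-! ### Real numbers from growing binary strings. -/

section DyadicIntervals

/-- The natural number with the given binary digits, most significant digit first. -/
def binVal (z : List Bool) : ℕ := natOfBits z.reverse

theorem binVal_append (z z' : List Bool) :
    binVal (z ++ z') = binVal z * 2 ^ z'.length + binVal z' := by
  rw [binVal, List.reverse_append, natOfBits_append, List.length_reverse, binVal, binVal]
  ring

theorem binVal_lt (z : List Bool) : binVal z < 2 ^ z.length := by
  simpa [binVal] using natOfBits_lt z.reverse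

theorem binVal_injOn {z z' : List Bool} (hl : z.length = z'.length) (h : binVal z = binVal z') :
    z = z' :=
  List.reverse_injective (natOfBits_injOn (by simpa using hl) h)

theorem primrec_binVal : Primrec binVal := primrec_natOfBits.comp Primrec.list_reverse

/-- Nested dyadic intervals have a common point. -/
theorem exists_mem_dyadic_intervals {z : ℕ → List Bool} (h : ∀ k, z k <+: z (k + 1)) :
    ∃ X : ℝ, ∀ k, (binVal (z k) : ℝ) ≤ X * 2 ^ (z k).length ∧
      X * 2 ^ (z k).length ≤ binVal (z k) + 1 := by
  have key : ∀ k, ∃ d : ℕ, ∃ v : ℕ, v < 2 ^ d ∧ (z (k + 1)).length = (z k).length + d ∧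
      binVal (z (k + 1)) = binVal (z k) * 2 ^ d + v := by
    intro k
    obtain ⟨π, hπ⟩ := h k
    refine ⟨π.length, binVal π, binVal_lt π, ?_, ?_⟩
    · rw [← hπ, List.length_append]
    · rw [← hπ, binVal_append]
  have hlo : Monotone fun k => (binVal (z k) : ℝ) / 2 ^ (z k).length := by
    refine monotone_nat_of_le_succ fun k => ?_
    obtain ⟨d, v, hv, h1, h2⟩ := key k
    rw [h1, h2, pow_add, div_le_div_iff₀ (by positivity) (by positivity)]
    push_cast
    nlinarith [show (0 : ℝ) ≤ v * 2 ^ (z k).length by positivity]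
  have hhi : Antitone fun k => ((binVal (z k) : ℝ) + 1) / 2 ^ (z k).length := by
    refine antitone_nat_of_succ_le fun k => ?_
    obtain ⟨d, v, hv, h1, h2⟩ := key k
    have hv' : (v : ℝ) + 1 ≤ 2 ^ d := by exact_mod_cast hv
    rw [h1, h2, pow_add, div_le_div_iff₀ (by positivity) (by positivity)]
    push_cast
    nlinarith [mul_le_mul_of_nonneg_right hv' (show (0 : ℝ) ≤ 2 ^ (z k).length by positivity)]
  have hle : ∀ k, (binVal (z k) : ℝ) / 2 ^ (z k).length ≤
      ((binVal (z k) : ℝ) + 1) / 2 ^ (z k).length := fun k =>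
    div_le_div_of_nonneg_right (by linarith) (by positivity)
  -- The closed intervals are nested, so the supremum of the left end points lies in all of them.
  -- The lengths of the strings need not tend to infinity.
  have hmem := hlo.ciSup_mem_iInter_Icc_of_antitone hhi hle
  refine ⟨⨆ k, (binVal (z k) : ℝ) / 2 ^ (z k).length, fun k => ?_⟩
  have hk := Set.mem_iInter.1 hmem k
  exact ⟨(div_le_iff₀ (by positivity)).1 hk.1, (le_div_iff₀ (by positivity)).1 hk.2⟩

theorem card_le_of_abs_sub_lt {F : Finset ℕ} {c ρ : ℝ} (hρ : 0 ≤ ρ)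
    (h : ∀ m ∈ F, |c - m| < ρ) : (F.card : ℝ) ≤ 2 * ρ + 1 := by
  have h1 : F.card ≤ (Finset.Icc ⌈c - ρ⌉ ⌊c + ρ⌋).card := by
    refine Finset.card_le_card_of_injOn (fun m => (m : ℤ)) (fun m hm => ?_)
      (fun a _ b _ e => Int.ofNat_injective e)
    have := abs_lt.1 (h m hm)
    simp only [Finset.coe_Icc, Set.mem_Icc, Int.ceil_le, Int.le_floor, Int.cast_natCast]
    constructor <;> linarith
  rw [Int.card_Icc] at h1
  have h2 : ((⌊c + ρ⌋ + 1 - ⌈c - ρ⌉).toNat : ℝ) ≤ 2 * ρ + 1 := by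
    rcases le_total 0 (⌊c + ρ⌋ + 1 - ⌈c - ρ⌉) with h0 | h0
    · have e : (((⌊c + ρ⌋ + 1 - ⌈c - ρ⌉).toNat : ℤ) : ℝ) = ((⌊c + ρ⌋ + 1 - ⌈c - ρ⌉ : ℤ) : ℝ) := by
        rw [Int.toNat_of_nonneg h0]
      have := Int.floor_le (c + ρ)
      have := Int.le_ceil (c - ρ)
      push_cast at e
      rw [e]
      linarith
    · rw [Int.toNat_of_nonpos h0]
      push_cast
      linarith
  exact le_trans (by exact_mod_cast h1) h2

end DyadicIntervals

/-! ### Digit strings compatible with a rational approximation. -/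

section Near

/-- Is the rational number coded by `τ` within `2 ^ (-r) + 2 ^ (-h - |z|)` of
`(D + 0.z) / 2 ^ h`, where `D = D₁ - D₂`? -/
def nearBase (D₁ D₂ h r : ℕ) (τ z : List Bool) : Bool :=
  let c := ((coordCodes τ).getD 0 0).unpair
  -- With `d` the denominator of the rational, the inequality is multiplied by `d * 2 ^ r * E` and
  -- negative terms change sides, leaving `|a - b| < d * (E + 2 ^ r)` in natural numbers.
  let E := 2 ^ (h + z.length)
  let a := 2 ^ r * (posPartOfCode c.1 * E + c.2 * (D₂ * 2 ^ z.length))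
  let b := 2 ^ r * (negPartOfCode c.1 * E + c.2 * (D₁ * 2 ^ z.length + binVal z))
  decide (a < b + c.2 * (E + 2 ^ r)) && decide (b < a + c.2 * (E + 2 ^ r))

theorem primrec_nearBase (D₁ D₂ h : ℕ) :
    Primrec fun q : ℕ × List Bool × List Bool => nearBase D₁ D₂ h q.1 q.2.1 q.2.2 := by
  have hr : Primrec fun q : ℕ × List Bool × List Bool => 2 ^ q.1 :=
    primrec_two_pow.comp Primrec.fst
  have hz : Primrec fun q : ℕ × List Bool × List Bool => q.2.2 := Primrec.snd.comp Primrec.snd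
  have hl : Primrec fun q : ℕ × List Bool × List Bool => q.2.2.length :=
    Primrec.list_length.comp hz
  have hc : Primrec fun q : ℕ × List Bool × List Bool => ((coordCodes q.2.1).getD 0 0).unpair :=
    Primrec.unpair.comp ((Primrec.list_getD 0).comp
      (primrec_coordCodes.comp (Primrec.fst.comp Primrec.snd)) (Primrec.const 0))
  have hc₂ : Primrec fun q : ℕ × List Bool × List Bool => ((coordCodes q.2.1).getD 0 0).unpair.2 :=
    Primrec.snd.comp hc
  have hE : Primrec fun q : ℕ × List Bool × List Bool => 2 ^ (h + q.2.2.length) :=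
    primrec_two_pow.comp (Primrec.nat_add.comp (Primrec.const h) hl)
  have hl2 : Primrec fun q : ℕ × List Bool × List Bool => 2 ^ q.2.2.length :=
    primrec_two_pow.comp hl
  have ha : Primrec fun q : ℕ × List Bool × List Bool =>
      2 ^ q.1 * (posPartOfCode ((coordCodes q.2.1).getD 0 0).unpair.1 * 2 ^ (h + q.2.2.length) +
        ((coordCodes q.2.1).getD 0 0).unpair.2 * (D₂ * 2 ^ q.2.2.length)) :=
    Primrec.nat_mul.comp hr (Primrec.nat_add.comp (Primrec.nat_mul.comp
      (primrec_posPartOfCode.comp (Primrec.fst.comp hc)) hE)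
      (Primrec.nat_mul.comp hc₂ (Primrec.nat_mul.comp (Primrec.const D₂) hl2)))
  have hb : Primrec fun q : ℕ × List Bool × List Bool =>
      2 ^ q.1 * (negPartOfCode ((coordCodes q.2.1).getD 0 0).unpair.1 * 2 ^ (h + q.2.2.length) +
        ((coordCodes q.2.1).getD 0 0).unpair.2 * (D₁ * 2 ^ q.2.2.length + binVal q.2.2)) :=
    Primrec.nat_mul.comp hr (Primrec.nat_add.comp (Primrec.nat_mul.comp
      (primrec_negPartOfCode.comp (Primrec.fst.comp hc)) hE)
      (Primrec.nat_mul.comp hc₂ (Primrec.nat_add.comp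
        (Primrec.nat_mul.comp (Primrec.const D₁) hl2) (primrec_binVal.comp hz))))
  have ht : Primrec fun q : ℕ × List Bool × List Bool =>
      ((coordCodes q.2.1).getD 0 0).unpair.2 * (2 ^ (h + q.2.2.length) + 2 ^ q.1) :=
    Primrec.nat_mul.comp hc₂ (Primrec.nat_add.comp hE hr)
  exact Primrec.and.comp (Primrec.nat_lt.decide.comp ha (Primrec.nat_add.comp hb ht))
    (Primrec.nat_lt.decide.comp hb (Primrec.nat_add.comp ha ht))

theorem nearBase_iff {D₁ D₂ h r : ℕ} {q : Fin 1 → ℚ} {z : List Bool} :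
    nearBase D₁ D₂ h r (ratVecCode q) z = true ↔
      |(((q 0 : ℚ) : ℝ) * 2 ^ h - ((D₁ : ℝ) - D₂)) * 2 ^ z.length - binVal z| <
        2 ^ (h + z.length) / 2 ^ r + 1 := by
  have hq := rat_eq_of_ratCode (q 0)
  have hd : 0 < (ratCode (q 0)).unpair.2 := by simp [ratCode, (q 0).den_pos]
  have hc : (coordCodes (ratVecCode q)).getD 0 0 = ratCode (q 0) := by
    rw [coordCodes_ratVecCode, List.getD_eq_getElem _ _ (by simp), List.getElem_ofFn]
    rfl
  simp only [nearBase, hc, Bool.and_eq_true, decide_eq_true_eq]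
  generalize posPartOfCode (ratCode (q 0)).unpair.1 = m at *
  generalize negPartOfCode (ratCode (q 0)).unpair.1 = m' at *
  generalize (ratCode (q 0)).unpair.2 = d at *
  have hd' : (0 : ℝ) < d := by exact_mod_cast hd
  have hq' : ((q 0 : ℚ) : ℝ) = ((m : ℝ) - m') / d := by
    rw [hq]; push_cast; rfl
  set ℓ := z.length
  have e1 : (((q 0 : ℚ) : ℝ) * 2 ^ h - ((D₁ : ℝ) - D₂)) * 2 ^ ℓ - binVal z =
      ((2 : ℝ) ^ r * (m * 2 ^ (h + ℓ) + d * (D₂ * 2 ^ ℓ)) -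
        2 ^ r * (m' * 2 ^ (h + ℓ) + d * (D₁ * 2 ^ ℓ + binVal z))) / (d * 2 ^ r) := by
    rw [hq', pow_add]
    field_simp
    ring
  have e2 : (2 : ℝ) ^ (h + ℓ) / 2 ^ r + 1 = (d * (2 ^ (h + ℓ) + 2 ^ r)) / (d * 2 ^ r) := by
    field_simp
  rw [e1, e2, abs_div, abs_of_pos (show (0 : ℝ) < d * 2 ^ r by positivity),
    div_lt_div_iff_of_pos_right (by positivity), abs_lt]
  rw [← Nat.cast_lt (α := ℝ), ← Nat.cast_lt (α := ℝ)]
  push_cast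
  constructor
  · rintro ⟨h1, h2⟩
    constructor <;> linarith
  · rintro ⟨h1, h2⟩
    constructor <;> linarith

/-- The values of the candidates are integers in an interval of radius `2 ^ (h + ℓ - r) + 1` (real
exponent). Truncating `ℓ - r` keeps the bound valid when `ℓ < r`, and the `3` absorbs the additive
constants. -/
theorem card_le_of_nearBase {D₁ D₂ h r ℓ : ℕ} {q : Fin 1 → ℚ} {F : Finset (List Bool)}
    (hF : ∀ z ∈ F, z.length = ℓ ∧ nearBase D₁ D₂ h r (ratVecCode q) z = true) :
    F.card ≤ 2 ^ (ℓ - r + h + 3) := by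
  have hinj : Set.InjOn binVal F := fun z hz z' hz' e =>
    binVal_injOn ((hF z hz).1.trans (hF z' hz').1.symm) e
  rw [← Finset.card_image_of_injOn hinj]
  have h1 : ((F.image binVal).card : ℝ) ≤ 2 * (2 ^ (h + ℓ) / 2 ^ r + 1) + 1 := by
    refine card_le_of_abs_sub_lt (c := (((q 0 : ℚ) : ℝ) * 2 ^ h - ((D₁ : ℝ) - D₂)) * 2 ^ ℓ)
      (by positivity) fun m hm => ?_
    obtain ⟨z, hz, rfl⟩ := Finset.mem_image.1 hm
    obtain ⟨hl, hn⟩ := hF z hz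
    have := nearBase_iff.1 hn
    rwa [hl] at this
  have h2 : (2 : ℝ) ^ (h + ℓ) / 2 ^ r ≤ 2 ^ (ℓ - r + h) := by
    rw [div_le_iff₀ (by positivity), ← pow_add]
    exact pow_le_pow_right₀ (by norm_num) (by omega)
  have h3 : (1 : ℝ) ≤ 2 ^ (ℓ - r + h) := one_le_pow₀ (by norm_num)
  have h4 : ((F.image binVal).card : ℝ) ≤ 2 ^ (ℓ - r + h + 3) := by
    rw [pow_add]
    linarith
  exact_mod_cast h4

end Near

/-! ### Logarithmic error terms. -/

section Sizes

theorem size_le_self (m : ℕ) : m.size ≤ m := Nat.size_le.2 Nat.lt_two_pow_self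

theorem size_mul_le (m k : ℕ) : (m * k).size ≤ m.size + k.size := by
  rw [Nat.size_le, pow_add]
  exact Nat.mul_lt_mul'' (Nat.lt_size_self m) (Nat.lt_size_self k)

/-- An elementary form of `log² m = O(m)`, enough to make logarithms negligible against linear
terms. -/
theorem sq_size_le (m : ℕ) : m.size ^ 2 ≤ 8 * m := by
  have key : ∀ t : ℕ, t ^ 2 ≤ 4 * 2 ^ t := by
    intro t
    induction t with
    | zero => norm_num
    | succ t ih =>
      have : t < 2 ^ t := Nat.lt_two_pow_self
      rw [pow_succ 2 t]
      nlinarith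
  rcases Nat.eq_zero_or_pos m with rfl | hm
  · simp
  · obtain ⟨t, ht⟩ := Nat.exists_eq_add_of_lt (Nat.size_pos.2 hm)
    have h1 : 2 ^ t ≤ m := Nat.lt_size.1 (by omega)
    have h2 := key m.size
    rw [show m.size = t + 1 by omega] at h2 ⊢
    rw [pow_succ 2 t] at h2
    omega

theorem exists_forall_size_le {δ : ℝ} (hδ : 0 < δ) :
    ∃ M : ℕ, ∀ m : ℕ, M ≤ m → (m.size : ℝ) ≤ δ * m := by
  obtain ⟨M, hM⟩ := exists_nat_ge (8 / δ ^ 2)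
  refine ⟨M, fun m hm => ?_⟩
  have h1 : ((m.size : ℝ)) ^ 2 ≤ 8 * m := by exact_mod_cast sq_size_le m
  have h2 : (8 : ℝ) ≤ m * δ ^ 2 := by
    rw [← div_le_iff₀ (by positivity)]
    exact hM.trans (by exact_mod_cast hm)
  refine le_of_sq_le_sq ?_ (by positivity)
  nlinarith [mul_le_mul_of_nonneg_right h2 (Nat.cast_nonneg (α := ℝ) m)]

/-- Lists are coded by iterated pairing, and each pairing at most doubles the total size. For fixed
length the factor is constant. -/
theorem exists_size_encode_list_le (n : ℕ) : ∃ c : ℕ, ∀ (B : ℕ) (l : List ℕ), l.length = n →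
    (∀ a ∈ l, a.size ≤ B) → (encode l).size ≤ c * (B + 1) := by
  induction n with
  | zero =>
    refine ⟨0, fun B l hl _ => ?_⟩
    rw [List.length_eq_zero_iff.1 hl]
    simp
  | succ n ih =>
    obtain ⟨c, hc⟩ := ih
    refine ⟨2 * c + 2, fun B l hl hB => ?_⟩
    obtain ⟨a, l, rfl⟩ := List.exists_cons_of_length_eq_add_one hl
    have h1 := hc B l (by simpa using hl) fun a ha => hB a (List.mem_cons_of_mem _ ha)
    have h2 := hB a List.mem_cons_self
    have h3 := size_pair_le a (encode l)
    have h4 := size_succ_le (Nat.pair a (encode l))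
    have e : encode (a :: l) = Nat.pair a (encode l) + 1 := rfl
    rw [e]
    nlinarith

end Sizes

/-! ### Euclidean balls and coordinatewise errors. -/

section Balls

variable {n : ℕ} {y : EuclideanSpace ℝ (Fin n)} {r : ℕ} {p : Fin n → ℚ}

theorem abs_sub_lt_of_mem_ratBall (h : p ∈ ratBall y r) (j : Fin n) :
    |(p j : ℝ) - y j| < 1 / 2 ^ r := by
  have h1 : dist (WithLp.toLp 2 fun i => (p i : ℝ)) y < (2 : ℝ) ^ (-(r : ℤ)) := h
  rw [dist_eq_norm, zpow_neg, zpow_natCast, ← one_div] at h1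
  refine lt_of_le_of_lt ?_ h1
  simpa using PiLp.norm_apply_le ((WithLp.toLp 2 fun i => (p i : ℝ)) - y) j

/-- Passing from coordinates to the Euclidean norm costs a factor `√n < 2 ^ n`, which `n` extra
binary places compensate. -/
theorem mem_ratBall_of_abs_sub_le {s : ℕ} (hs : r + n ≤ s)
    (h : ∀ j, |(p j : ℝ) - y j| ≤ 1 / 2 ^ s) : p ∈ ratBall y r := by
  show dist (WithLp.toLp 2 fun i => (p i : ℝ)) y < (2 : ℝ) ^ (-(r : ℤ))
  rw [EuclideanSpace.dist_eq, zpow_neg, zpow_natCast, ← one_div,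
    Real.sqrt_lt' (by positivity)]
  have h1 : ∑ j, dist ((WithLp.toLp 2 fun i => (p i : ℝ)) j) (y j) ^ 2 ≤
      ∑ _j : Fin n, ((1 : ℝ) / 2 ^ s) ^ 2 := by
    refine Finset.sum_le_sum fun j _ => pow_le_pow_left₀ dist_nonneg ?_ 2
    rw [Real.dist_eq]
    exact h j
  refine h1.trans_lt ?_
  rw [Finset.sum_const, Finset.card_univ, Fintype.card_fin, nsmul_eq_mul, div_pow, div_pow,
    one_pow, mul_one_div, div_lt_div_iff₀ (by positivity) (by positivity)]
  have h2 : (n : ℝ) < 2 ^ n := by exact_mod_cast Nat.lt_two_pow_self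
  have h3 : ((2 : ℝ) ^ n * 2 ^ r) ≤ 2 ^ s := by
    rw [← pow_add]
    exact pow_le_pow_right₀ (by norm_num) (by omega)
  have h4 : (1 : ℝ) ≤ 2 ^ n := one_le_pow₀ (by norm_num)
  have h5 : (0 : ℝ) < 2 ^ r := by positivity
  calc (n : ℝ) * (2 ^ r) ^ 2 < 2 ^ n * (2 ^ r) ^ 2 := by gcongr
    _ ≤ 2 ^ n * 2 ^ n * (2 ^ r) ^ 2 := by nlinarith [mul_pos (mul_pos (show (0:ℝ) < 2 ^ n by positivity) h5) h5]
    _ = (2 ^ n * 2 ^ r) ^ 2 := by ring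
    _ ≤ (2 ^ s) ^ 2 := pow_le_pow_left₀ (by positivity) h3 2
    _ = 1 * (2 ^ s) ^ 2 := (one_mul _).symm

end Balls

/-! ### Complexity of grid points near a given rational point. -/

section GridPoints

variable {A : Set (List Bool)} {U : List Bool → List Bool →. List Bool}

/-- The complexity of a grid point near a rational point. -/
theorem IsUniversalMachine.K_gridRat_le (hU : IsUniversalMachine A U) (n : ℕ) :
    ∃ C : ℕ, ∀ (s w : ℕ) (p : Fin n → ℚ) (z : Fin n → ℤ), (∀ j, |z j - ⌊p j * 2 ^ s⌋| ≤ w) →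
      K U (ratVecCode fun j => gridRat s (z j)) [] ≤ K U (ratVecCode p) [] +
        C * (s.size + w.size + (K U (ratVecCode p) []).size + 1) := by
  obtain ⟨c, hc⟩ := hU.K_map_le primrec_shiftVec
  obtain ⟨c', hc'⟩ := exists_size_encode_list_le n
  refine ⟨100 + 150 * c' + c, fun s w p z h => ?_⟩
  -- Adding `w` makes the offsets natural numbers, at most `2 w`. The advice that turns `p` into the
  -- grid point thus has size `O(log s + log w)`.
  set v : List ℕ := List.ofFn fun j => (z j - ⌊p j * 2 ^ s⌋ + w).toNat with hv
  have hz : (ratVecCode fun j => gridRat s (z j)) =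
      shiftVec (Nat.pair s (Nat.pair w (encode v))) (ratVecCode p) := by
    rw [shiftVec_ratVecCode]
    congr 1
    funext j
    congr 1
    have hj := abs_le.1 (h j)
    rw [hv, List.getD_eq_getElem _ _ (by simp), List.getElem_ofFn]
    simp only [Fin.eta]
    rw [Int.toNat_of_nonneg (by linarith)]
    ring
  have hs : (encode v).size ≤ c' * (w.size + 2 + 1) := by
    refine hc' _ v (by simp [hv]) fun a ha => ?_
    obtain ⟨j, rfl⟩ := List.mem_ofFn.1 ha
    have hj := abs_le.1 (h j)
    have : (z j - ⌊p j * 2 ^ s⌋ + w).toNat ≤ 2 * w := by omega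
    refine (Nat.size_le_size this).trans ((size_mul_le 2 w).trans ?_)
    have : Nat.size 2 = 2 := by decide
    omega
  rw [hz]
  refine (hc _ _).trans ?_
  have h1 := size_pair_le s (Nat.pair w (encode v))
  have h2 := size_pair_le w (encode v)
  obtain ⟨T, hT⟩ : ∃ T, T = s.size + w.size + (K U (ratVecCode p) []).size + 1 := ⟨_, rfl⟩
  have h3 : c' * (w.size + 2 + 1) ≤ c' * (3 * T) := Nat.mul_le_mul_left c' (by omega)
  have h4 : c ≤ c * T := Nat.le_mul_of_pos_right c (by omega)
  rw [← hT, show (100 + 150 * c' + c) * T = 100 * T + 150 * (c' * T) + c * T by ring]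
  rw [show c' * (3 * T) = 3 * (c' * T) by ring] at h3
  omega

end GridPoints

/-! ### Grid approximations of a point at square precisions. -/

section GridApproximations

variable {A : Set (List Bool)} {U : List Bool → List Bool →. List Bool} {n : ℕ}

/-- The approximation of the point `y` by a grid point to precision `k ^ 2`. -/
noncomputable def gridApprox (y : EuclideanSpace ℝ (Fin n)) (k : ℕ) : Fin n → ℚ :=
  fun j => gridRat (k * k) ⌊y j * 2 ^ (k * k)⌋

/-- The complexity of the grid approximations of `y`. -/
noncomputable def gridK (U : List Bool → List Bool →. List Bool) (y : EuclideanSpace ℝ (Fin n))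
    (k : ℕ) : ℕ := K U (ratVecCode (gridApprox y k)) []

/-- The complexity of the grid approximations of `y` given the previous ones. -/
noncomputable def gridKStep (U : List Bool → List Bool →. List Bool)
    (y : EuclideanSpace ℝ (Fin n)) (k : ℕ) : ℕ :=
  K U (ratVecCode (gridApprox y (k + 1))) (ratVecCode (gridApprox y k))

theorem gridApprox_mem_ratBall (y : EuclideanSpace ℝ (Fin n)) {k r : ℕ} (h : r + n ≤ k * k) :
    gridApprox y k ∈ ratBall y r :=
  mem_ratBall_of_abs_sub_le h fun j => abs_gridRat_sub_le (k * k) (y j)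

/-- The grid point is obtained from the zero vector by offsets of `O(k²)` bits. This crude bound
makes logarithms of complexities `O(log k)`. -/
theorem IsUniversalMachine.gridK_le_quadratic (hU : IsUniversalMachine A U)
    (y : EuclideanSpace ℝ (Fin n)) : ∃ C : ℕ, ∀ k, gridK U y k ≤ C * (k * k + 1) := by
  obtain ⟨C, hC⟩ := hU.K_gridRat_le n
  obtain ⟨B, hB⟩ := exists_nat_ge (∑ j, |y j| + 1)
  set κ := K U (ratVecCode (0 : Fin n → ℚ)) [] with hκ
  refine ⟨κ + C * (B.size + κ.size + 4), fun k => ?_⟩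
  have h := hC (k * k) (B * 2 ^ (k * k)) 0 (fun j => ⌊y j * 2 ^ (k * k)⌋) fun j => ?_
  · have h1 := size_le_self (k * k)
    have h2 := size_mul_le B (2 ^ (k * k))
    rw [Nat.size_pow] at h2
    have h3 : (k * k).size + (B * 2 ^ (k * k)).size + κ.size + 1 ≤
        (B.size + κ.size + 4) * (k * k + 1) := by nlinarith
    refine h.trans ?_
    rw [← hκ]
    have h4 := Nat.mul_le_mul_left C h3
    nlinarith
  · have hy : |y j| + 1 ≤ B := by
      refine le_trans ?_ hB
      have := Finset.single_le_sum (f := fun j => |y j|) (fun i _ => abs_nonneg _)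
        (Finset.mem_univ j)
      simpa using this
    have hp : (1 : ℝ) ≤ 2 ^ (k * k) := one_le_pow₀ (by norm_num)
    have h1 := Int.floor_le (y j * 2 ^ (k * k))
    have h2 := Int.lt_floor_add_one (y j * 2 ^ (k * k))
    have h3 := abs_le.1 (le_refl |y j|)
    have h4 : |((⌊y j * 2 ^ (k * k)⌋ : ℤ) : ℝ)| ≤ B * 2 ^ (k * k) := by
      rw [abs_le]
      constructor <;> nlinarith
    simp only [Pi.zero_apply, zero_mul, Int.floor_zero, sub_zero]
    show |⌊y j * 2 ^ (k * k)⌋| ≤ ((B * 2 ^ (k * k) : ℕ) : ℤ)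
    exact_mod_cast h4

theorem Kpt_le {y : EuclideanSpace ℝ (Fin n)} {r : ℕ} {p : Fin n → ℚ} (hp : p ∈ ratBall y r) :
    Kpt U r y ≤ K U (ratVecCode p) [] :=
  Nat.sInf_le ⟨p, hp, rfl⟩

theorem exists_K_eq_Kpt (U : List Bool → List Bool →. List Bool) (y : EuclideanSpace ℝ (Fin n))
    (r : ℕ) : ∃ p ∈ ratBall y r, K U (ratVecCode p) [] = Kpt U r y := by
  obtain ⟨p, hp⟩ := ratBall_nonempty y r
  exact Nat.sInf_mem (s := {k | ∃ p ∈ ratBall y r, K U (ratVecCode p) [] = k}) ⟨_, p, hp, rfl⟩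

/-- An optimal rational point of the ball of radius `2 ^ (-r)` has grid indices within `2 ^ (k² - r
+ 1)` of those of `y`. Correcting them costs `O(k² - r)` bits, up to logarithms. -/
theorem IsUniversalMachine.gridK_le_Kpt (hU : IsUniversalMachine A U) (n : ℕ) :
    ∃ C : ℕ, ∀ (y : EuclideanSpace ℝ (Fin n)) (k r : ℕ), r ≤ k * k → gridK U y k ≤
      Kpt U r y + C * ((k * k).size + (k * k - r) + (Kpt U r y).size + 1) := by
  obtain ⟨C, hC⟩ := hU.K_gridRat_le n
  refine ⟨3 * C, fun y k r hr => ?_⟩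
  obtain ⟨p, hp, hK⟩ := exists_K_eq_Kpt U y r
  have h := hC (k * k) (2 ^ (k * k - r + 1)) p (fun j => ⌊y j * 2 ^ (k * k)⌋) fun j => ?_
  · rw [hK, Nat.size_pow] at h
    refine h.trans (Nat.add_le_add_left ?_ _)
    rw [mul_comm 3 C, mul_assoc]
    exact Nat.mul_le_mul_left C (by omega)
  · have h1 := Int.floor_le (y j * 2 ^ (k * k))
    have h2 := Int.lt_floor_add_one (y j * 2 ^ (k * k))
    have h3 : ((⌊p j * 2 ^ (k * k)⌋ : ℤ) : ℝ) ≤ p j * 2 ^ (k * k) := by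
      exact_mod_cast Int.floor_le (p j * 2 ^ (k * k))
    have h4 : (p j : ℝ) * 2 ^ (k * k) < (⌊p j * 2 ^ (k * k)⌋ : ℤ) + 1 := by
      exact_mod_cast Int.lt_floor_add_one (p j * 2 ^ (k * k))
    have h5 := abs_lt.1 (abs_sub_lt_of_mem_ratBall hp j)
    have h6 : (2 : ℝ) ^ (k * k) = 2 ^ (k * k - r) * 2 ^ r := by
      rw [← pow_add, Nat.sub_add_cancel hr]
    have hpos : (0 : ℝ) < 2 ^ (k * k) := by positivity
    have h7 : (1 : ℝ) / 2 ^ r * 2 ^ (k * k) = 2 ^ (k * k - r) := by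
      rw [h6]; field_simp
    have h8 : (p j - y j) * 2 ^ (k * k) ≤ 2 ^ (k * k - r) := by
      rw [← h7]; exact mul_le_mul_of_nonneg_right h5.2.le hpos.le
    have h9 : -(2 : ℝ) ^ (k * k - r) ≤ (p j - y j) * 2 ^ (k * k) := by
      rw [← h7, ← neg_mul]; exact mul_le_mul_of_nonneg_right h5.1.le hpos.le
    have h10 : (1 : ℝ) ≤ 2 ^ (k * k - r) := one_le_pow₀ (by norm_num)
    have h11 : |(((⌊y j * 2 ^ (k * k)⌋ - ⌊p j * 2 ^ (k * k)⌋ : ℤ)) : ℝ)| ≤ 2 ^ (k * k - r + 1) := by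
      rw [pow_succ, abs_le]
      push_cast
      constructor <;> nlinarith
    exact_mod_cast h11

/-- The chain rule is applied to the map rounding to the grid of precision `i²`; at `i = k` it sends
each approximation to its predecessor. -/
theorem IsUniversalMachine.gridKStep_add_le (hU : IsUniversalMachine A U) (n : ℕ) :
    ∃ c : ℕ, ∀ (y : EuclideanSpace ℝ (Fin n)) (k : ℕ), gridKStep U y k + gridK U y k ≤
      gridK U y (k + 1) + 60 * (k.size + (gridK U y (k + 1)).size) + c := by
  have hf : Primrec₂ fun (i : ℕ) (σ : List Bool) =>
      shiftVec (Nat.pair (i * i) (Nat.pair 0 (encode ([] : List ℕ)))) σ :=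
    primrec_shiftVec.comp (Primrec₂.natPair.comp (Primrec.nat_mul.comp Primrec.fst Primrec.fst)
      (Primrec.const _)) Primrec.snd
  obtain ⟨c, hc⟩ := hU.K_add_K_le hf
  refine ⟨c, fun y k => ?_⟩
  have h := hc k (ratVecCode (gridApprox y (k + 1)))
  have e : shiftVec (Nat.pair (k * k) (Nat.pair 0 (encode ([] : List ℕ))))
      (ratVecCode (gridApprox y (k + 1))) = ratVecCode (gridApprox y k) := by
    rw [shiftVec_ratVecCode]
    congr 1
    funext j
    rw [gridApprox, gridApprox, floor_gridRat_mul (by nlinarith)]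
    simp
  rw [e] at h
  exact h

end GridApproximations

/-! ### Length of the stored description and recovery of `y` from it. -/

section Lengths

variable {A : Set (List Bool)} {U : List Bool → List Bool →. List Bool} {n : ℕ}

theorem size_le_of_le_quadratic {C m k : ℕ} (h : m ≤ C * ((k + 1) * (k + 1))) :
    m.size ≤ C.size + 2 * (k + 1).size := by
  have h1 := Nat.size_le_size h
  have h2 := size_mul_le C ((k + 1) * (k + 1))
  have h3 := size_mul_le (k + 1) (k + 1)
  omega

/-- The total length of the optimal programs that lead from each grid approximation of `y` to the
next one is not much more than the complexity of `y` at the final precision. -/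
theorem IsUniversalMachine.sum_gridKStep_le (hU : IsUniversalMachine A U)
    (y : EuclideanSpace ℝ (Fin n)) : ∃ C : ℕ, ∀ k : ℕ,
      ∑ i ∈ Finset.range k, gridKStep U y i ≤ C * ((k + 1) * (k + 1)) ∧
      ∀ r, r + n ≤ k * k → k * k ≤ r + n + 1 + 2 * k →
        ∑ i ∈ Finset.range k, gridKStep U y i ≤ Kpt U r y + C * ((k + 1) * (k + 1).size) := by
  obtain ⟨C₁, h₁⟩ := hU.gridK_le_quadratic y
  obtain ⟨C₂, h₂⟩ := hU.gridK_le_Kpt n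
  obtain ⟨c, h₃⟩ := hU.gridKStep_add_le n
  set a := 180 + 60 * C₁.size + c with ha
  refine ⟨C₂ * (n + 10 + C₁.size) + a + C₁, fun k => ?_⟩
  set e := (k + 1).size with he
  have e0 : 1 ≤ e := Nat.size_pos.2 (Nat.succ_pos k)
  have hq : ∀ i ≤ k, gridK U y i ≤ C₁ * ((k + 1) * (k + 1)) := fun i hi =>
    (h₁ i).trans (Nat.mul_le_mul_left _ (by nlinarith))
  -- The chain rule inequalities telescope; each step loses `O(log k)`, bounded by `a * e`.
  have hsum : ∀ i ≤ k, ∑ j ∈ Finset.range i, gridKStep U y j ≤ gridK U y i + i * (a * e) := by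
    intro i
    induction i with
    | zero => intro _; simp
    | succ i ih =>
      intro hi
      have g1 := ih (by omega)
      have g2 := h₃ y i
      have g3 := size_le_of_le_quadratic (hq (i + 1) hi)
      have g4 : i.size ≤ e := Nat.size_le_size (by omega)
      rw [Finset.sum_range_succ]
      have g5 : 60 * (i.size + (gridK U y (i + 1)).size) + c ≤ a * e := by
        rw [ha]
        nlinarith
      rw [Nat.succ_mul]
      omega
  have hk := hsum k le_rfl
  have hT : k * (a * e) ≤ a * ((k + 1) * e) := by nlinarith [Nat.zero_le (a * e)]
  refine ⟨?_, fun r hr hr' => ?_⟩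
  · have g1 : e ≤ k + 1 := size_le_self (k + 1)
    have g2 : a * ((k + 1) * e) ≤ a * ((k + 1) * (k + 1)) :=
      Nat.mul_le_mul_left _ (Nat.mul_le_mul_left _ g1)
    have g3 := hq k le_rfl
    calc _ ≤ C₁ * ((k + 1) * (k + 1)) + a * ((k + 1) * (k + 1)) := by omega
      _ = (a + C₁) * ((k + 1) * (k + 1)) := by ring
      _ ≤ _ := Nat.mul_le_mul_right _ (by omega)
  · have g1 := h₂ y k r (by omega)
    have g2 : Kpt U r y ≤ gridK U y k := Kpt_le (gridApprox_mem_ratBall y hr)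
    have g3 := size_le_of_le_quadratic (g2.trans (hq k le_rfl))
    have g4 : (k * k).size ≤ 2 * e := by
      have := Nat.size_le_size (show k * k ≤ (k + 1) * (k + 1) by nlinarith)
      have := size_mul_le (k + 1) (k + 1)
      omega
    have g5 : k + e ≤ (k + 1) * e := by nlinarith
    have g6 : (k * k).size + (k * k - r) + (Kpt U r y).size + 1 ≤
        (n + 10 + C₁.size) * ((k + 1) * e) := by
      have : (n + 2 + C₁.size) * 1 ≤ (n + 2 + C₁.size) * ((k + 1) * e) :=
        Nat.mul_le_mul_left _ (by omega)
      have : (n + 10 + C₁.size) * ((k + 1) * e) =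
          (n + 2 + C₁.size) * ((k + 1) * e) + 8 * ((k + 1) * e) := by ring
      omega
    have g7 := Nat.mul_le_mul_left C₂ g6
    calc _ ≤ Kpt U r y + C₂ * ((n + 10 + C₁.size) * ((k + 1) * e)) + a * ((k + 1) * e) := by omega
      _ = Kpt U r y + (C₂ * (n + 10 + C₁.size) + a) * ((k + 1) * e) := by ring
      _ ≤ _ := Nat.add_le_add_left (Nat.mul_le_mul_right _ (by omega)) _

/-- Concatenations of optimal programs that lead from each grid approximation of `y` to the next
one. -/
theorem IsUniversalMachine.exists_isChain_gridApprox (hU : IsUniversalMachine A U)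
    (y : EuclideanSpace ℝ (Fin n)) : ∃ z : ℕ → List Bool, (∀ k, z k <+: z (k + 1)) ∧
      ∀ k, (z k).length = ∑ i ∈ Finset.range k, gridKStep U y i ∧
        IsChain U (ratVecCode (gridApprox y 0)) k (z k) (ratVecCode (gridApprox y k)) := by
  choose π hπ hl using fun k => hU.exists_length_eq_K (ratVecCode (gridApprox y (k + 1)))
    (ratVecCode (gridApprox y k))
  have hs : ∀ k, (List.range (k + 1)).flatMap π = (List.range k).flatMap π ++ π k := fun k => by
    simp [List.range_succ]
  refine ⟨fun k => (List.range k).flatMap π, fun k => ?_, fun k => ?_⟩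
  · show _ <+: (List.range (k + 1)).flatMap π
    rw [hs]
    exact List.prefix_append _ _
  · induction k with
    | zero => exact ⟨rfl, rfl, rfl⟩
    | succ k ih =>
      refine ⟨?_, _, _, π k, ih.2, hπ k, hs k⟩
      show ((List.range (k + 1)).flatMap π).length = _
      rw [hs, List.length_append, ih.1, hl, Finset.sum_range_succ]
      rfl

/-- One approximation `p` that is simple given every admissible `q` bounds each inner minimum, hence
the maximum. -/
theorem KptCond_le {m : ℕ} {x : EuclideanSpace ℝ (Fin n)} {y : EuclideanSpace ℝ (Fin m)}
    {r s N : ℕ} {p : Fin n → ℚ} (hp : p ∈ ratBall x r)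
    (h : ∀ q ∈ ratBall y s, K U (ratVecCode p) (ratVecCode q) ≤ N) : KptCond U r s x y ≤ N := by
  obtain ⟨q, hq⟩ := ratBall_nonempty y s
  refine csSup_le ⟨_, q, hq, rfl⟩ ?_
  rintro _ ⟨q, hq, rfl⟩
  exact (Nat.sInf_le (s := {l | ∃ p ∈ ratBall x r, K U (ratVecCode p) (ratVecCode q) = l})
    ⟨p, hp, rfl⟩).trans (h q hq)

/-- There is a real number `X` such that every `(D + X) / 2 ^ h` carries as much information on
`y` as there is room for, at every precision. -/
theorem IsUniversalMachine.exists_KptCond_le (hU : IsUniversalMachine A U)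
    (y : EuclideanSpace ℝ (Fin n)) : ∃ X : ℝ, ∀ (D : ℤ) (h : ℕ), ∃ C : ℕ, ∀ k r : ℕ,
      r + n ≤ k * k → k * k ≤ r + n + 1 + 2 * k →
        KptCond U r r y (WithLp.toLp 2 ![((D : ℝ) + X) / 2 ^ h]) ≤
          (Kpt U r y + C * ((k + 1) * (k + 1).size) - r) + C * ((k + 1) * (k + 1).size) := by
  obtain ⟨z, hz, hz'⟩ := hU.exists_isChain_gridApprox y
  obtain ⟨X, hX⟩ := exists_mem_dyadic_intervals hz
  obtain ⟨C₁, h₁⟩ := hU.sum_gridKStep_le y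
  refine ⟨X, fun D h => ?_⟩
  -- The starting point `gridApprox y 0` and the numbers `D`, `h` are built into the enumeration, so
  -- the constant depends on them.
  obtain ⟨c, hc⟩ := hU.K_le_of_isChain (ratVecCode (gridApprox y 0))
    (primrec_nearBase D.toNat (-D).toNat h)
  refine ⟨C₁ + (100 + 16 * C₁.size + 4 * (C₁ + h + 3).size + c + h + 3), fun k r hr hr' => ?_⟩
  obtain ⟨hlen, hch⟩ := hz' k
  obtain ⟨s1, s2⟩ := h₁ k
  have s3 := s2 r hr hr'
  rw [← hlen] at s1 s3
  set ℓ := (z k).length with hℓ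
  set e := (k + 1).size with he
  have e0 : 1 ≤ e := Nat.size_pos.2 (Nat.succ_pos k)
  refine KptCond_le (gridApprox_mem_ratBall y hr) fun q hq => ?_
  -- Two errors add up: `q` is within `2 ^ (-r)` of `x`, and the first `ℓ` digits give `X` within `2
  -- ^ (-ℓ)`, hence `x` within `2 ^ (-h - ℓ)`.
  have hnear : nearBase D.toNat (-D).toNat h r (ratVecCode q) (z k) = true := by
    rw [nearBase_iff]
    have hD : ((D.toNat : ℝ) - ((-D).toNat : ℝ)) = D := by
      exact_mod_cast congrArg (Int.cast : ℤ → ℝ) (Int.toNat_sub_toNat_neg D)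
    have hq' : |((q 0 : ℚ) : ℝ) - ((D : ℝ) + X) / 2 ^ h| < 1 / 2 ^ r := by
      simpa using abs_sub_lt_of_mem_ratBall hq 0
    obtain ⟨x1, x2⟩ := hX k
    have ee : (((q 0 : ℚ) : ℝ) * 2 ^ h - D) * 2 ^ ℓ - binVal (z k) =
        (((q 0 : ℚ) : ℝ) - ((D : ℝ) + X) / 2 ^ h) * 2 ^ (h + ℓ) +
          (X * 2 ^ ℓ - binVal (z k)) := by
      rw [pow_add]
      field_simp
      ring
    rw [hD, ← hℓ, ee]
    refine lt_of_le_of_lt (abs_add_le _ _) (add_lt_add_of_lt_of_le ?_ ?_)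
    · rw [abs_mul, abs_of_pos (show (0 : ℝ) < 2 ^ (h + ℓ) by positivity)]
      calc _ < 1 / 2 ^ r * (2 : ℝ) ^ (h + ℓ) := mul_lt_mul_of_pos_right hq' (by positivity)
        _ = _ := by ring
    · rw [abs_le]
      constructor <;> linarith
  have hK := hc k r (z k) _ _ (ℓ - r + h + 3) hch hnear fun F hF => card_le_of_nearBase hF
  rw [← hℓ] at hK
  have p1 := size_pair_le (Nat.pair k (Nat.pair r ℓ)) (ℓ - r + h + 3)
  have p2 := size_pair_le k (Nat.pair r ℓ)
  have p3 := size_pair_le r ℓ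
  have q1 : k.size ≤ e := Nat.size_le_size (by omega)
  have q2 := size_le_of_le_quadratic s1
  have q3 : r.size ≤ 2 * e := by
    have := Nat.size_le_size (show r ≤ (k + 1) * (k + 1) by nlinarith)
    have := size_mul_le (k + 1) (k + 1)
    omega
  have q4 : (ℓ - r + h + 3).size ≤ (C₁ + h + 3).size + 2 * e := by
    refine size_le_of_le_quadratic ?_
    have : 1 ≤ (k + 1) * (k + 1) := Nat.one_le_iff_ne_zero.2 (by positivity)
    have : (h + 3) * 1 ≤ (h + 3) * ((k + 1) * (k + 1)) := Nat.mul_le_mul_left _ this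
    have : (C₁ + h + 3) * ((k + 1) * (k + 1)) =
        C₁ * ((k + 1) * (k + 1)) + (h + 3) * ((k + 1) * (k + 1)) := by ring
    omega
  set T := (k + 1) * e with hT
  have hT1 : e ≤ T := Nat.le_mul_of_pos_left e (Nat.succ_pos k)
  set b := 16 * C₁.size + 4 * (C₁ + h + 3).size + c + h + 3 with hb
  have r1 : b * 1 ≤ b * T := Nat.mul_le_mul_left b (e0.trans hT1)
  have r2 : (C₁ + (100 + b)) * T = C₁ * T + 100 * T + b * T := by ring
  have r3 : 100 + 16 * C₁.size + 4 * (C₁ + h + 3).size + c + h + 3 = 100 + b := by omega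
  rw [r3, r2]
  omega

end Lengths

end AlgInfo

/-! ### The dense set and the final estimate. -/

theorem lemma4p1 (n : ℕ) (y : EuclideanSpace ℝ (Fin n)) (A : Set (List Bool))
    (U : List Bool → List Bool →. List Bool) (hU : AlgInfo.IsUniversalMachine A U)
    (ε : ℝ) (hε : 0 < ε) :
    ∃ S : Set ℝ, Dense S ∧ ∀ x ∈ S, ∃ r₀ : ℕ, ∀ r : ℕ, r₀ ≤ r →
      (AlgInfo.KptCond U r r y !₂[x] : ℝ) ≤
        max ((AlgInfo.Kpt U r y : ℝ) - (1 - ε) * (r : ℝ)) (ε * (r : ℝ)) := by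
  obtain ⟨X, hX⟩ := hU.exists_KptCond_le y
  refine ⟨{x | ∃ (D : ℤ) (h : ℕ), x = ((D : ℝ) + X) / 2 ^ h}, ?_, ?_⟩
  · refine dense_of_exists_between fun a b hab => ?_
    obtain ⟨h, hh⟩ := exists_pow_lt_of_lt_one (sub_pos.2 hab) (by norm_num : (1 / 2 : ℝ) < 1)
    have hp : (0 : ℝ) < 2 ^ h := by positivity
    rw [one_div, inv_pow, inv_lt_iff_one_lt_mul₀ hp] at hh
    have h1 := Int.floor_le (a * 2 ^ h - X)
    have h2 := Int.lt_floor_add_one (a * 2 ^ h - X)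
    refine ⟨_, ⟨⌊a * 2 ^ h - X⌋ + 1, h, rfl⟩, ?_, ?_⟩
    · rw [lt_div_iff₀ hp]
      push_cast
      linarith
    · rw [div_lt_iff₀ hp]
      push_cast
      linarith
  · rintro _ ⟨D, h, rfl⟩
    obtain ⟨C, hC⟩ := hX D h
    -- Chosen so that, with `T ≤ δ * (m + 2)²` and `(m + 2)² ≤ 4 r`, the two error terms `C * T`
    -- together are at most `ε r`.
    have hδ : 0 < ε / (8 * (C + 1)) := by positivity
    obtain ⟨M, hM⟩ := AlgInfo.exists_forall_size_le hδ
    refine ⟨M * M + n + 5, fun r hr => ?_⟩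
    -- The precision used is `k = m + 1`: the least `k` with `k² > r + n + 1`, so that `k²` exceeds
    -- `r + n` by at most `2 k`.
    set m := Nat.sqrt (r + n + 1) with hm
    have m1 : m * m ≤ r + n + 1 := Nat.sqrt_le _
    have m2 : r + n + 1 < (m + 1) * (m + 1) := Nat.lt_succ_sqrt (r + n + 1)
    have m3 : M ≤ m := Nat.le_sqrt.2 (by omega)
    have hK := hC (m + 1) r (by omega) (by nlinarith)
    have hs := hM (m + 1 + 1) (by omega)
    set T := (m + 1 + 1) * (m + 1 + 1).size with hT
    have hsq : (((m + 1 + 1 : ℕ) : ℝ)) * ((m + 1 + 1 : ℕ) : ℝ) ≤ 4 * r := by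
      have : (m + 1 + 1) * (m + 1 + 1) ≤ 4 * r := by nlinarith [sq_nonneg ((m : ℤ) - 2)]
      exact_mod_cast this
    have hTr : (2 * C * T : ℝ) ≤ ε * r := by
      have t1 : (T : ℝ) ≤ ε / (8 * (C + 1)) * (4 * r) := by
        rw [hT, Nat.cast_mul]
        calc (((m + 1 + 1 : ℕ) : ℝ)) * (m + 1 + 1).size
            ≤ ((m + 1 + 1 : ℕ) : ℝ) * (ε / (8 * (C + 1)) * ((m + 1 + 1 : ℕ) : ℝ)) := by gcongr
          _ = ε / (8 * (C + 1)) * (((m + 1 + 1 : ℕ) : ℝ) * ((m + 1 + 1 : ℕ) : ℝ)) := by ring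
          _ ≤ _ := by gcongr
      calc (2 * C * T : ℝ) ≤ 2 * (C + 1) * (ε / (8 * (C + 1)) * (4 * r)) := by
            gcongr
            linarith
        _ = ε * r := by field_simp; ring
    have hK' : (AlgInfo.KptCond U r r y !₂[((D : ℝ) + X) / 2 ^ h] : ℝ) ≤
        ((AlgInfo.Kpt U r y + C * T - r : ℕ) : ℝ) + C * T := by exact_mod_cast hK
    have hCT : (0 : ℝ) ≤ C * T := by positivity
    -- The truncated difference vanishes in the first case, which gives the bound `ε r`; otherwise
    -- it is a true difference and the other term of the maximum applies.
    rcases le_total (AlgInfo.Kpt U r y + C * T) r with hle | hle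
    · rw [Nat.sub_eq_zero_of_le hle] at hK'
      refine le_max_of_le_right ?_
      push_cast at hK'
      linarith
    · rw [Nat.cast_sub hle] at hK'
      refine le_max_of_le_left ?_
      push_cast at hK'
      linarith
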